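/- Let $M$ be a smooth $7$-manifold with a $G_2$-structure $(\varphi,g)$: $\varphi$ is a smooth $3$-form which at each point is carried by some linear isomorphism $T_xM\cong\mathbb R^7$ to $\varphi_0=e^{123}+e^{145}+e^{167}+e^{246}-e^{257}-e^{347}-e^{356}$, and $g$ is the Riemannian metric determined by $\varphi$, namely $g_{ab}=(\det s)^{-1/9}s_{ab}$ with $s_{ab}=\frac1{144}\varphi_{amn}\varphi_{bpq}\varphi_{rst}\hat\varepsilon^{mnpqrst}$. Let $\psi=*\varphi$, where the Hodge star is that of $g$ and the volume form $(\det s)^{1/9}\,dx^{1}\wedge\dots\wedge dx^{7}$ determined by $\varphi$, and let $\nabla$ be the Levi-Civita connection of $g$. The full torsion tensor $T$ is given by $$T_{am}=\tfrac1{24}(\nabla_a\varphi_{bcd})\,\psi_m{}^{bcd}$$ (so that $\nabla_a\varphi_{bcd}=T_a{}^e\psi_{ebcd}$), and its torsion components are the function $\tau_1$, the $1$-form $\tau_7$, the $2$-form $\tau_{14}$ with $(\tau_{14})^{ab}\varphi_{abc}=0$ and the traceless symmetric $2$-tensor $\tau_{27}$ in the splitting $$T=\tau_1 g+\tau_7\lrcorner\varphi+\tau_{14}+\tau_{27},\qquad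 (\alpha\lrcorner\varphi)_{bc}=\alpha^a\varphi_{abc},$$ whose four summands are the components of $T$ in $W_1$, $W_7$, $W_{14}$, $W_{27}$. Let $f$ be a nowhere vanishing smooth function on $M$ and put $\tilde\varphi=f^3\varphi$, $\tilde g=f^2g$. Then $(\tilde\varphi,\tilde g)$ is a $G_2$-structure, and its full torsion tensor is $$\tilde T=fT-df\lrcorner\varphi ,$$ where the contraction is taken with respect to $g$. The torsion components of both structures exist and are unique. The components of the torsion in $W_1$, $W_{14}$ and $W_{27}$ are multiplied by $f$, that is, $\tilde\tau_1\tilde g=f\,\tau_1 g$ (equivalently $\tilde\tau_1=f^{-1}\tau_1$), $\tilde\tau_{14}=f\tau_{14}$ and $\tilde\tau_{27}=f\tau_{27}$. The component in $W_7$ becomes $f\,\tau_7\lrcorner\varphi-df\lrcorner\varphi$, that is, $\tilde\tau_7=\tau_7-f^{-1}df$. -/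

import Mathlib

open scoped Manifold ContDiff

noncomputable section

namespace G2

/-! ### Linear algebra of positive 3-forms, in components -/

/-- The decomposable 3-form `e^{ijk} = e^i ∧ e^j ∧ e^k` on `ℝ⁷`: its value on `(u, v, w)` is the
`3 × 3` determinant of the coordinates `i, j, k` of `u, v, w`. -/
def e3 (i j k : Fin 7) : (Fin 7 → ℝ) [⋀^Fin 3]→ₗ[ℝ] ℝ :=
  (Matrix.detRowAlternating : (Fin 3 → ℝ) [⋀^Fin 3]→ₗ[ℝ] ℝ).compLinearMap
    (LinearMap.funLeft ℝ ℝ ![i, j, k])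

/-- The model form `φ₀ = e¹²³ + e¹⁴⁵ + e¹⁶⁷ + e²⁴⁶ - e²⁵⁷ - e³⁴⁷ - e³⁵⁶`
(with the indices `1, …, 7` written as `0, …, 6`). -/
def phi0 : (Fin 7 → ℝ) [⋀^Fin 3]→ₗ[ℝ] ℝ :=
  e3 0 1 2 + e3 0 3 4 + e3 0 5 6 + e3 1 3 5 - e3 1 4 6 - e3 2 3 6 - e3 2 4 5

/-- A 3-form on a real vector space `V` is positive if some linear isomorphism `V ≃ ℝ⁷`
carries it to `φ₀`. -/
def IsPositive {V : Type*} [AddCommGroup V] [Module ℝ V] (φ : V [⋀^Fin 3]→ₗ[ℝ] ℝ) : Prop :=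
  ∃ L : V ≃ₗ[ℝ] (Fin 7 → ℝ), φ = phi0.compLinearMap (L : V →ₗ[ℝ] (Fin 7 → ℝ))

/-- Components of 3-tensors with respect to a basis. -/
abbrev Comp3 := Fin 7 → Fin 7 → Fin 7 → ℝ

/-- Components of 4-tensors with respect to a basis. -/
abbrev Comp4 := Fin 7 → Fin 7 → Fin 7 → Fin 7 → ℝ

/-- The alternating symbol `ε̂^{i₁…i₇}`, with `ε̂^{12…7} = 1`. -/
def altSymbol (i : Fin 7 → Fin 7) : ℝ :=
  ((1 : Matrix (Fin 7) (Fin 7) ℝ).submatrix i id).det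

/-- `s_{ab} = (1/144) φ_{amn} φ_{bpq} φ_{rst} ε̂^{mnpqrst}`. -/
def sMatrix (φ : Comp3) : Matrix (Fin 7) (Fin 7) ℝ :=
  Matrix.of fun a b => (1 / 144) * ∑ i : Fin 7 → Fin 7,
    altSymbol i * φ a (i 0) (i 1) * φ b (i 2) (i 3) * φ (i 4) (i 5) (i 6)

/-- The real ninth root (an odd function on `ℝ`). -/
def ninthRoot (t : ℝ) : ℝ := (SignType.sign t : ℝ) * |t| ^ (1 / 9 : ℝ)

/-- The coefficient `(det s)^{1/9}` of the volume form determined by `φ`: the volume form has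
components `(det s)^{1/9} ε̂_{i₁…i₇}`. In particular `φ` fixes the orientation. -/
def volCoeff (φ : Comp3) : ℝ := ninthRoot (sMatrix φ).det

/-- The metric determined by `φ`: `g_{ab} = (det s)^{-1/9} s_{ab}`. -/
def metricComp (φ : Comp3) : Matrix (Fin 7) (Fin 7) ℝ := (volCoeff φ)⁻¹ • sMatrix φ

/-- The 4-form `ψ = ∗φ`: with `ε` the volume form of `φ`,
`ψ_{mnpq} = (1/3!) ε_{abcmnpq} φ^{abc}`, indices being raised with `g`. -/
def psiComp (g : Matrix (Fin 7) (Fin 7) ℝ) (φ : Comp3) : Comp4 := fun m n p q =>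
  (1 / 6) * ∑ a, ∑ b, ∑ c, volCoeff φ * altSymbol ![a, b, c, m, n, p, q] *
    ∑ a', ∑ b', ∑ c', g⁻¹ a a' * g⁻¹ b b' * g⁻¹ c c' * φ a' b' c'

/-! ### `G₂`-structures on a 7-manifold -/

section Manifold

variable {M : Type*} [TopologicalSpace M] [ChartedSpace (EuclideanSpace ℝ (Fin 7)) M]

variable (M) in
/-- Fields of 3-forms on `M`. -/
abbrev Form3 := ∀ x : M, TangentSpace (𝓡 7) x [⋀^Fin 3]→ₗ[ℝ] ℝ

variable (M) in
/-- Fields of bilinear forms, that is, of covariant 2-tensors, on `M`. -/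
abbrev Tensor2 := ∀ x : M, LinearMap.BilinForm ℝ (TangentSpace (𝓡 7) x)

variable (M) in
/-- Fields of 1-forms on `M`. -/
abbrev Form1 := ∀ x : M, Module.Dual ℝ (TangentSpace (𝓡 7) x)

/-- The coordinate basis of `T_x M` given by the preferred chart at `x`. Mathlib's `T_x M` is, by
definition, the model space `ℝ⁷` read through that chart, so this is the standard basis. -/
def coordBasis (x : M) : Module.Basis (Fin 7) ℝ (TangentSpace (𝓡 7) x) :=
  (EuclideanSpace.basisFun (Fin 7) ℝ).toBasis

/-- The components `φ_{abc}` of a 3-form at `x`. -/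
def comp3 (φ : Form3 M) (x : M) : Comp3 := fun a b c =>
  φ x ![coordBasis x a, coordBasis x b, coordBasis x c]

/-- The components `g_{ab}` of a 2-tensor at `x`. -/
def comp2 (g : Tensor2 M) (x : M) : Matrix (Fin 7) (Fin 7) ℝ :=
  Matrix.of fun a b => g x (coordBasis x a) (coordBasis x b)

/-- The coordinate vector field `∂_a` of the chart at `x₀`, at the point with coordinates `u`. -/
def coordField (x₀ : M) (u : EuclideanSpace ℝ (Fin 7)) (a : Fin 7) :
    TangentSpace (𝓡 7) ((extChartAt (𝓡 7) x₀).symm u) :=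
  mfderiv (𝓡 7) (𝓡 7) (extChartAt (𝓡 7) x₀).symm u
    (EuclideanSpace.single a (1 : ℝ) : EuclideanSpace ℝ (Fin 7))

/-- The component functions `φ_{abc}` of a 3-form in the chart at `x₀`. -/
def chartComp3 (φ : Form3 M) (x₀ : M) (a b c : Fin 7) (u : EuclideanSpace ℝ (Fin 7)) : ℝ :=
  φ ((extChartAt (𝓡 7) x₀).symm u) ![coordField x₀ u a, coordField x₀ u b, coordField x₀ u c]

/-- The component functions `g_{ab}` of a 2-tensor in the chart at `x₀`. -/
def chartComp2 (g : Tensor2 M) (x₀ : M) (a b : Fin 7) (u : EuclideanSpace ℝ (Fin 7)) : ℝ :=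
  g ((extChartAt (𝓡 7) x₀).symm u) (coordField x₀ u a) (coordField x₀ u b)

/-- The pair `(φ, g)` is a `G₂`-structure on `M`: `φ` is a smooth positive 3-form and `g` is the
(smooth) Riemannian metric determined by `φ`. -/
structure IsG2Structure (φ : Form3 M) (g : Tensor2 M) : Prop where
  smooth_form : ∀ (x₀ : M) (a b c : Fin 7),
    ContDiffOn ℝ ∞ (chartComp3 φ x₀ a b c) (extChartAt (𝓡 7) x₀).target
  smooth_metric : ∀ (x₀ : M) (a b : Fin 7),
    ContDiffOn ℝ ∞ (chartComp2 g x₀ a b) (extChartAt (𝓡 7) x₀).target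
  positive : ∀ x : M, IsPositive (φ x)
  metric_eq : ∀ x : M, comp2 g x = metricComp (comp3 φ x)

/-! ### The Levi-Civita derivative of `φ` and the full torsion tensor -/

/-- The partial derivative `∂_a h`. -/
def pderiv (a : Fin 7) (h : EuclideanSpace ℝ (Fin 7) → ℝ) (u : EuclideanSpace ℝ (Fin 7)) : ℝ :=
  fderiv ℝ h u (EuclideanSpace.single a (1 : ℝ))

/-- The Christoffel symbols of the Levi-Civita connection of `g` at `x`, in the chart at `x`:
`Γ_a{}^e{}_b = (1/2) g^{ed} (∂_b g_{da} + ∂_a g_{db} - ∂_d g_{ab})`. -/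
def christoffel (g : Tensor2 M) (x : M) (a e b : Fin 7) : ℝ :=
  (1 / 2) * ∑ d, (comp2 g x)⁻¹ e d *
    (pderiv b (chartComp2 g x d a) (extChartAt (𝓡 7) x x)
      + pderiv a (chartComp2 g x d b) (extChartAt (𝓡 7) x x)
      - pderiv d (chartComp2 g x a b) (extChartAt (𝓡 7) x x))

/-- The components `∇_a φ_{bcd}` at `x`, for the Levi-Civita connection `∇` of `g`. -/
def covDeriv (g : Tensor2 M) (φ : Form3 M) (x : M) (a b c d : Fin 7) : ℝ :=
  pderiv a (chartComp3 φ x b c d) (extChartAt (𝓡 7) x x)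
    - ∑ e, (christoffel g x a e b * comp3 φ x e c d
      + christoffel g x a e c * comp3 φ x b e d
      + christoffel g x a e d * comp3 φ x b c e)

/-- The full torsion tensor `T` of the `G₂`-structure `(φ, g)`, the 2-tensor that is determined by
`∇_a φ_{bcd} = T_a{}^e ψ_{ebcd}`, that is,
`T_{am} = (1/24) (∇_a φ_{bcd}) ψ_m{}^{bcd}` with `ψ = ∗φ`. -/
def fullTorsion (φ : Form3 M) (g : Tensor2 M) : Tensor2 M := fun x =>
  Matrix.toBilin (coordBasis x) (Matrix.of fun a m =>
    (1 / 24) * ∑ b, ∑ c, ∑ d, covDeriv g φ x a b c d *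
      ∑ b', ∑ c', ∑ d', (comp2 g x)⁻¹ b b' * (comp2 g x)⁻¹ c c' * (comp2 g x)⁻¹ d d' *
        psiComp (comp2 g x) (comp3 φ x) m b' c' d')

/-! ### Contractions and the torsion components -/

/-- The contraction `(α ⌟ φ)_{bc} = g^{ae} α_e φ_{abc}` of a 1-form with a 3-form. -/
def contract1 (g : Tensor2 M) (α : Form1 M) (φ : Form3 M) : Tensor2 M := fun x =>
  Matrix.toBilin (coordBasis x) (Matrix.of fun b c =>
    ∑ a, ∑ e, (comp2 g x)⁻¹ a e * α x (coordBasis x e) * comp3 φ x a b c)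

/-- The components of the contraction `(β ⌟ φ)_c = g^{aa'} g^{bb'} β_{a'b'} φ_{abc}` of a 2-tensor
with a 3-form. -/
def contract2 (g : Tensor2 M) (β : Tensor2 M) (φ : Form3 M) (x : M) (c : Fin 7) : ℝ :=
  ∑ a, ∑ b, ∑ a', ∑ b', (comp2 g x)⁻¹ a a' * (comp2 g x)⁻¹ b b' * comp2 β x a' b' *
    comp3 φ x a b c

/-- The trace `g^{ab} h_{ab}`. -/
def traceWith (g : Tensor2 M) (h : Tensor2 M) (x : M) : ℝ :=
  ∑ a, ∑ b, (comp2 g x)⁻¹ a b * comp2 h x a b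

variable (M) in
/-- A quadruple `(τ₁, τ₇, τ₁₄, τ₂₇)` of a function, a 1-form and two 2-tensors. -/
structure TorsionComponents where
  τ₁ : M → ℝ
  τ₇ : Form1 M
  τ₁₄ : Tensor2 M
  τ₂₇ : Tensor2 M

/-- `τ` consists of the torsion components of `(φ, g)`: the full torsion splits as
`T = τ₁ g + τ₇ ⌟ φ + τ₁₄ + τ₂₇`, where `τ₁₄` lies in `Λ²₁₄`, i.e. it is a 2-form with
`τ₁₄ ⌟ φ = 0`, and `τ₂₇` is symmetric and traceless. The four summands are the components of `T`
in `W₁`, `W₇`, `W₁₄` and `W₂₇`. -/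
structure AreTorsionComponents (φ : Form3 M) (g : Tensor2 M) (τ : TorsionComponents M) :
    Prop where
  splitting : ∀ x : M, fullTorsion φ g x =
    τ.τ₁ x • g x + contract1 g τ.τ₇ φ x + τ.τ₁₄ x + τ.τ₂₇ x
  alt_14 : ∀ x : M, (τ.τ₁₄ x).IsAlt
  contract_14 : ∀ (x : M) (c : Fin 7), contract2 g τ.τ₁₄ φ x c = 0
  symm_27 : ∀ x : M, (τ.τ₂₇ x).IsSymm
  trace_27 : ∀ x : M, traceWith g τ.τ₂₇ x = 0

/-- The differential `df` of a function, as a 1-form. -/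
def differential (f : M → ℝ) : Form1 M := fun x => (mvfderiv (𝓡 7) f x : _ →L[ℝ] ℝ).toLinearMap

end Manifold

end G2

end

noncomputable section

namespace G2

open Matrix

/-! ### The alternating symbol -/

/-! Everything is reduced to one point. There a positive form is φ = P*φ₀ for an invertible matrix
P, and then s = det P · PᵀP, (det s)^{1/9} = det P, g = PᵀP and ψ = P*ψ₀ (`sMatrix_frame3`,
`volCoeff_frame3`, `metricComp_frame3`, `psiComp_frame3`). Replacing P by fP scales φ, g, ψ by f³,
f², f⁴, for either sign of f. The contraction identities φ_{acd}φ_b{}^{cd} = 6g_{ab} and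
φ_{acd}ψ_{mb}{}^{cd} = 4φ_{amb} hold because finite computations verify them for φ₀ and ψ₀.

For the torsion, the Christoffel symbols change by f⁻¹(δ^e_a f_b + δ^e_b f_a − f^e g_{ab}), with f_a
= ∂_a f (`christoffelComp_conformal`). In ∇̃φ̃ the derivative of f³ cancels against the terms
containing df_a φ_{bcd}; what remains is f³∇φ minus f² times a skew expression in df, g and φ
(`covDerivComp_conformal`). Contracting with ψ̃ turns that expression into df ⌟ φ, so T̃ = fT − df ⌟
φ (`torsionComp_conformal`).

The splitting of a 2-tensor exists and is unique at each point: the trace isolates τ₁, contraction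
with φ isolates τ₇. Since α ⌟ φ scales by f, the term −df ⌟ φ is absorbed by τ₇ alone
(`IsSplitting.conformal`), and uniqueness identifies the components. -/

/-- The sign of `b - a`, for indices `a`, `b`. -/
def ordSign (a b : Fin 7) : ℤ := if a < b then 1 else if b < a then -1 else 0

/-- The sign of a permutation is a product over pairs, and a repeated index kills both sides. The
integer form makes the symbol computable. -/
lemma altSymbol_eq_prod (v : Fin 7 → Fin 7) :
    altSymbol v = ((∏ j, ∏ i ∈ Finset.Iio j, ordSign (v i) (v j) : ℤ) : ℝ) := by
  by_cases hv : Function.Injective v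
  · obtain ⟨σ, rfl⟩ : ∃ σ : Equiv.Perm (Fin 7), ⇑σ = v :=
      ⟨Equiv.ofBijective v (Finite.injective_iff_bijective.1 hv), rfl⟩
    rw [altSymbol, Matrix.det_permute, Matrix.det_one, mul_one, Equiv.Perm.sign_eq_prod_prod_Iio]
    simp only [Units.coe_prod]
    congr 1
    refine Finset.prod_congr rfl fun j _ => Finset.prod_congr rfl fun i hi => ?_
    have hne : σ i ≠ σ j := fun h => (Finset.mem_Iio.1 hi).ne (σ.injective h)
    rcases lt_or_gt_of_ne hne with h | h
    · simp [ordSign, h]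
    · simp [ordSign, h, h.not_gt]
  · obtain ⟨i, j, hij, hne⟩ : ∃ i j, v i = v j ∧ i < j := by
      simp only [Function.Injective, not_forall] at hv
      obtain ⟨i, j, h, hne⟩ := hv
      rcases lt_or_gt_of_ne hne with h' | h'
      · exact ⟨i, j, h, h'⟩
      · exact ⟨j, i, h.symm, h'⟩
    rw [altSymbol, Matrix.det_zero_of_row_eq hne.ne (by
      ext k
      change (1 : Matrix (Fin 7) (Fin 7) ℝ) (v i) k = (1 : Matrix (Fin 7) (Fin 7) ℝ) (v j) k
      rw [hij])]
    symm
    rw [Int.cast_eq_zero]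
    refine Finset.prod_eq_zero (Finset.mem_univ j) (Finset.prod_eq_zero (Finset.mem_Iio.2 hne) ?_)
    simp [ordSign, hij]

/-- The value of the alternating symbol as a product over pairs that vanishes early. -/
def altInt (a b c m n p q : Fin 7) : ℤ :=
  if a = m ∨ a = n ∨ a = p ∨ a = q ∨ b = m ∨ b = n ∨ b = p ∨ b = q ∨ c = m ∨ c = n ∨ c = p ∨ c = q
      ∨ m = n ∨ m = p ∨ m = q ∨ n = p ∨ n = q ∨ p = q then 0 else
  ordSign a b * ordSign a c * ordSign b c *
    (ordSign a m * ordSign b m * ordSign c m) *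
    (ordSign a n * ordSign b n * ordSign c n * ordSign m n) *
    (ordSign a p * ordSign b p * ordSign c p * ordSign m p * ordSign n p) *
    (ordSign a q * ordSign b q * ordSign c q * ordSign m q * ordSign n q * ordSign p q)

lemma altSymbol_cons (a b c m n p q : Fin 7) :
    altSymbol ![a, b, c, m, n, p, q] = (altInt a b c m n p q : ℝ) := by
  rw [altSymbol_eq_prod, altInt]
  congr 1
  have h0 : ∀ x, ordSign x x = 0 := fun x => by simp [ordSign]
  have e0 : Finset.Iio (0 : Fin 7) = ∅ := by decide
  have e1 : Finset.Iio (1 : Fin 7) = {0} := by decide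
  have e2 : Finset.Iio (2 : Fin 7) = {0, 1} := by decide
  have e3 : Finset.Iio (3 : Fin 7) = {0, 1, 2} := by decide
  have e4 : Finset.Iio (4 : Fin 7) = {0, 1, 2, 3} := by decide
  have e5 : Finset.Iio (5 : Fin 7) = {0, 1, 2, 3, 4} := by decide
  have e6 : Finset.Iio (6 : Fin 7) = {0, 1, 2, 3, 4, 5} := by decide
  rw [Fin.prod_univ_seven, e0, e1, e2, e3, e4, e5, e6]
  rw [Finset.prod_insert (by decide), Finset.prod_insert (by decide), Finset.prod_insert (by decide),
    Finset.prod_insert (by decide), Finset.prod_insert (by decide), Finset.prod_insert (by decide),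
    Finset.prod_insert (by decide), Finset.prod_insert (by decide), Finset.prod_insert (by decide),
    Finset.prod_insert (by decide), Finset.prod_insert (by decide), Finset.prod_insert (by decide),
    Finset.prod_insert (by decide), Finset.prod_insert (by decide), Finset.prod_insert (by decide)]
  simp only [Finset.prod_singleton, Finset.prod_empty]
  change _ * (ordSign a b) * (ordSign a c * ordSign b c) *
    (ordSign a m * (ordSign b m * ordSign c m)) *
    (ordSign a n * (ordSign b n * (ordSign c n * ordSign m n))) *
    (ordSign a p * (ordSign b p * (ordSign c p * (ordSign m p * ordSign n p)))) *
    (ordSign a q * (ordSign b q * (ordSign c q * (ordSign m q * (ordSign n q * ordSign p q))))) = _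
  split_ifs with h
  · rcases h with h | h | h | h | h | h | h | h | h | h | h | h | h | h | h | h | h | h <;>
      simp [h, h0]
  · ring

lemma altSymbol_comp_perm (v : Fin 7 → Fin 7) (σ : Equiv.Perm (Fin 7)) :
    altSymbol (v ∘ σ) = Equiv.Perm.sign σ * altSymbol v := by
  rw [altSymbol, altSymbol, ← Matrix.det_permute]
  rfl

lemma altSymbol_swap01 (a b c m n p q : Fin 7) :
    altSymbol ![b, a, c, m, n, p, q] = - altSymbol ![a, b, c, m, n, p, q] := by
  have := altSymbol_comp_perm ![a, b, c, m, n, p, q] (Equiv.swap 0 1)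
  rw [Equiv.Perm.sign_swap (by decide)] at this
  convert this using 1
  · congr 1; ext i; fin_cases i <;> rfl
  · simp

lemma altSymbol_swap12 (a b c m n p q : Fin 7) :
    altSymbol ![a, c, b, m, n, p, q] = - altSymbol ![a, b, c, m, n, p, q] := by
  have := altSymbol_comp_perm ![a, b, c, m, n, p, q] (Equiv.swap 1 2)
  rw [Equiv.Perm.sign_swap (by decide)] at this
  convert this using 1
  · congr 1; ext i; fin_cases i <;> rfl
  · simp

/-- A 7-cycle is even. This reconciles `sMatrix`, where the third φ takes the last three indices of
the symbol, with `psiComp`, where φ takes the first three. -/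
lemma altSymbol_rotate (r s t m n p q : Fin 7) :
    altSymbol ![m, n, p, q, r, s, t] = altSymbol ![r, s, t, m, n, p, q] := by
  have := altSymbol_comp_perm ![r, s, t, m, n, p, q] (finRotate 7 ^ 3)
  rw [map_pow, sign_finRotate] at this
  convert this using 1
  · congr 1; ext i; fin_cases i <;> rfl
  · simp

/-! ### The model form and its dual -/

/-- The components of `φ₀` as digits in base `3` of a numeral. -/
def phiInt (i j k : Fin 7) : ℤ :=
  -- The entry (i, j, k) is the digit in position 49i + 7j + k, lowered by one to lie in {−1, 0, 1};
  -- `phiInt_eq` verifies the numeral.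
  ((22467781506953686921882136737159915861540419133546247639680328892294283780819291789826897006851729865670084814326742136520956851672919134517942097771795146900816293
      / 3 ^ (49 * i.val + 7 * j.val + k.val) % 3 : ℕ) : ℤ) - 1

/-- The components of `ψ₀ = ∗φ₀`. -/
def psiInt (i j k l : Fin 7) : ℤ :=
  -- This is the identity φ_{ijm}φ_{klm} = δ_{ik}δ_{jl} − δ_{il}δ_{jk} + ψ_{ijkl} solved for ψ;
  -- `psiInt_eq` checks its agreement with the Hodge dual.
  phiInt i j 0 * phiInt k l 0 + phiInt i j 1 * phiInt k l 1 + phiInt i j 2 * phiInt k l 2 +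
    phiInt i j 3 * phiInt k l 3 + phiInt i j 4 * phiInt k l 4 + phiInt i j 5 * phiInt k l 5 +
    phiInt i j 6 * phiInt k l 6
    - (if i = k then if j = l then 1 else 0 else 0) + (if i = l then if j = k then 1 else 0 else 0)

/-- The Kronecker symbol. -/
def kron (a i : Fin 7) : ℤ := if a = i then 1 else 0

/-- The components of `e^{ijk}`. -/
def e3Int (i j k a b c : Fin 7) : ℤ :=
  kron a i * kron b j * kron c k - kron a i * kron b k * kron c j
    - kron a j * kron b i * kron c k + kron a j * kron b k * kron c i
    + kron a k * kron b i * kron c j - kron a k * kron b j * kron c i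

lemma e3_single (i j k a b c : Fin 7) :
    e3 i j k ![Pi.single a 1, Pi.single b 1, Pi.single c 1] = (e3Int i j k a b c : ℝ) := by
  have hk : ∀ x y : Fin 7, ((kron x y : ℤ) : ℝ) = Pi.single (M := fun _ => ℝ) x 1 y := fun x y => by
    simp [kron, Pi.single_apply, eq_comm]
  change Matrix.det (Matrix.of fun r => LinearMap.funLeft ℝ ℝ ![i, j, k]
    (![Pi.single a 1, Pi.single b 1, Pi.single c 1] r)) = _
  rw [Matrix.det_fin_three, e3Int]
  push_cast
  simp only [hk]
  simp only [Matrix.of_apply, LinearMap.funLeft_apply, Matrix.cons_val_zero,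
    Matrix.cons_val_one, Matrix.cons_val]

lemma sum_e3Int (i j k : Fin 7) (h : Fin 7 → Fin 7 → Fin 7 → ℝ) :
    ∑ a, ∑ b, ∑ c, h a b c * (e3Int i j k a b c : ℝ) =
      h i j k - h i k j - h j i k + h j k i + h k i j - h k j i := by
  have hk : ∀ x y : Fin 7, ((kron x y : ℤ) : ℝ) = if x = y then 1 else 0 := fun x y => by
    simp [kron]
  have h1 : ∀ x y z : Fin 7, ∑ a, ∑ b, ∑ c, h a b c *
      ((kron a x : ℝ) * (kron b y : ℝ) * (kron c z : ℝ)) = h x y z := fun x y z => by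
    simp only [hk]
    simp
  rw [← h1 i j k, ← h1 i k j, ← h1 j i k, ← h1 j k i, ← h1 k i j, ← h1 k j i]
  simp only [← Finset.sum_add_distrib, ← Finset.sum_sub_distrib]
  refine Finset.sum_congr rfl fun a _ => Finset.sum_congr rfl fun b _ =>
    Finset.sum_congr rfl fun c _ => ?_
  simp only [e3Int]
  push_cast
  ring

/-- The six orderings of i, j, k contribute equally, the sign of the symbol cancelling that of the
determinant. -/
lemma sum_altSymbol_e3Int (i j k m n p q : Fin 7) :
    ∑ a, ∑ b, ∑ c, altSymbol ![a, b, c, m, n, p, q] * (e3Int i j k a b c : ℝ) =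
      6 * (altInt i j k m n p q : ℝ) := by
  rw [sum_e3Int i j k fun a b c => altSymbol ![a, b, c, m, n, p, q], ← altSymbol_cons]
  have h1 := altSymbol_swap12 i j k m n p q
  have h2 := altSymbol_swap01 i j k m n p q
  have h3 := altSymbol_swap12 j i k m n p q
  have h4 := altSymbol_swap01 i k j m n p q
  have h5 := altSymbol_swap12 k i j m n p q
  rw [h5, h4, h3, h2, h1]
  ring

lemma phiInt_eq : ∀ a b c : Fin 7, phiInt a b c =
    e3Int 0 1 2 a b c + e3Int 0 3 4 a b c + e3Int 0 5 6 a b c + e3Int 1 3 5 a b c -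
      e3Int 1 4 6 a b c - e3Int 2 3 6 a b c - e3Int 2 4 5 a b c := by
  decide +kernel

lemma psiInt_eq : ∀ m n p q : Fin 7, psiInt m n p q =
    altInt 0 1 2 m n p q + altInt 0 3 4 m n p q + altInt 0 5 6 m n p q + altInt 1 3 5 m n p q -
      altInt 1 4 6 m n p q - altInt 2 3 6 m n p q - altInt 2 4 5 m n p q := by
  decide +kernel

/-- The sum over the seven indices. -/
def sum7 (h : Fin 7 → ℤ) : ℤ := h 0 + h 1 + h 2 + h 3 + h 4 + h 5 + h 6

lemma sum7_eq (h : Fin 7 → ℤ) : sum7 h = ∑ i, h i := (Fin.sum_univ_seven h).symm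

/-- This and `phiInt_psiInt` are the two contraction identities for the model forms, checked by
evaluation; all later ones are their transports by a frame. -/
lemma phiInt_phiInt : ∀ i j : Fin 7, (sum7 fun c => sum7 fun d => phiInt i c d * phiInt j c d) =
    if i = j then 6 else 0 := by
  decide +kernel

lemma phiInt_psiInt : ∀ i m n : Fin 7,
    (sum7 fun c => sum7 fun d => phiInt i c d * psiInt m n c d) = 4 * phiInt i m n := by
  decide +kernel

lemma phiInt_swap : ∀ i j k : Fin 7, phiInt i j k = - phiInt j i k ∧ phiInt i j k = - phiInt i k j := by
  decide +kernel

lemma psiInt_swap : ∀ i j k l : Fin 7,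
    psiInt i j k l = - psiInt i k j l ∧ psiInt i j k l = - psiInt i j l k := by
  decide +kernel

lemma phi0_single (a b c : Fin 7) :
    phi0 ![Pi.single a 1, Pi.single b 1, Pi.single c 1] = (phiInt a b c : ℝ) := by
  rw [phiInt_eq]
  simp only [phi0, AlternatingMap.add_apply, AlternatingMap.sub_apply, e3_single]
  push_cast
  rfl

lemma sum_altSymbol_phiInt (m n p q : Fin 7) :
    ∑ a, ∑ b, ∑ c, altSymbol ![a, b, c, m, n, p, q] * (phiInt a b c : ℝ) =
      6 * (psiInt m n p q : ℝ) := by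
  rw [psiInt_eq]
  simp only [phiInt_eq]
  push_cast
  simp only [mul_add, mul_sub, Finset.sum_add_distrib, Finset.sum_sub_distrib,
    sum_altSymbol_e3Int]

lemma sum_phiInt_phiInt (i j : Fin 7) :
    ∑ c, ∑ d, (phiInt i c d : ℝ) * phiInt j c d = if i = j then 6 else 0 := by
  have := phiInt_phiInt i j
  simp only [sum7_eq] at this
  exact_mod_cast this

lemma sum_phiInt_psiInt (i m n : Fin 7) :
    ∑ c, ∑ d, (phiInt i c d : ℝ) * psiInt m n c d = 4 * phiInt i m n := by
  have := phiInt_psiInt i m n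
  simp only [sum7_eq] at this
  exact_mod_cast this

/-! ### Change of frame -/

/-- Packing nested sums into one sum over a product lets a single `Finset.sum_comm` exchange whole
blocks of indices. -/
lemma sum_three {R : Type*} [AddCommMonoid R] (h : Fin 7 → Fin 7 → Fin 7 → R) :
    ∑ a, ∑ b, ∑ c, h a b c = ∑ t : Fin 7 × Fin 7 × Fin 7, h t.1 t.2.1 t.2.2 := by
  simp only [Fintype.sum_prod_type]

lemma sum_four {R : Type*} [AddCommMonoid R] (h : Fin 7 → Fin 7 → Fin 7 → Fin 7 → R) :
    ∑ a, ∑ b, ∑ c, ∑ d, h a b c d =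
      ∑ t : Fin 7 × Fin 7 × Fin 7 × Fin 7, h t.1 t.2.1 t.2.2.1 t.2.2.2 := by
  simp only [Fintype.sum_prod_type]

section AlternatingMap

variable (f : (Fin 7 → ℝ) [⋀^Fin 7]→ₗ[ℝ] ℝ) (c : Fin 7 → ℝ) (v : Fin 7 → Fin 7 → ℝ)
  (x y z m n p q : Fin 7 → ℝ)

lemma map_update_sum_smul (w : Fin 7 → Fin 7 → ℝ) (s : Fin 7) :
    f (Function.update w s (∑ a, c a • v a)) = ∑ a, c a * f (Function.update w s (v a)) := by
  have := map_sum (f.toMultilinearMap.toLinearMap w s) (fun a => c a • v a) Finset.univ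
  simpa only [map_smul, MultilinearMap.toLinearMap_apply, AlternatingMap.coe_multilinearMap,
    smul_eq_mul] using this

lemma map_sum_slot_0 : f ![∑ a, c a • v a, y, z, m, n, p, q] = ∑ a, c a * f ![v a, y, z, m, n, p, q] := by
  have h : ∀ t, Function.update ![0, y, z, m, n, p, q] 0 t = ![t, y, z, m, n, p, q] := fun t => by
    ext i; fin_cases i <;> rfl
  simpa only [h] using map_update_sum_smul f c v ![0, y, z, m, n, p, q] 0

lemma map_sum_slot_1 : f ![x, ∑ a, c a • v a, z, m, n, p, q] = ∑ a, c a * f ![x, v a, z, m, n, p, q] := by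
  have h : ∀ t, Function.update ![x, 0, z, m, n, p, q] 1 t = ![x, t, z, m, n, p, q] := fun t => by
    ext i; fin_cases i <;> rfl
  simpa only [h] using map_update_sum_smul f c v ![x, 0, z, m, n, p, q] 1

lemma map_sum_slot_2 : f ![x, y, ∑ a, c a • v a, m, n, p, q] = ∑ a, c a * f ![x, y, v a, m, n, p, q] := by
  have h : ∀ t, Function.update ![x, y, 0, m, n, p, q] 2 t = ![x, y, t, m, n, p, q] := fun t => by
    ext i; fin_cases i <;> rfl
  simpa only [h] using map_update_sum_smul f c v ![x, y, 0, m, n, p, q] 2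

lemma map_sum_slot_3 : f ![x, y, z, ∑ a, c a • v a, n, p, q] = ∑ a, c a * f ![x, y, z, v a, n, p, q] := by
  have h : ∀ t, Function.update ![x, y, z, 0, n, p, q] 3 t = ![x, y, z, t, n, p, q] := fun t => by
    ext i; fin_cases i <;> rfl
  simpa only [h] using map_update_sum_smul f c v ![x, y, z, 0, n, p, q] 3

lemma map_sum_slot_4 : f ![x, y, z, m, ∑ a, c a • v a, p, q] = ∑ a, c a * f ![x, y, z, m, v a, p, q] := by
  have h : ∀ t, Function.update ![x, y, z, m, 0, p, q] 4 t = ![x, y, z, m, t, p, q] := fun t => by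
    ext i; fin_cases i <;> rfl
  simpa only [h] using map_update_sum_smul f c v ![x, y, z, m, 0, p, q] 4

lemma map_sum_slot_5 : f ![x, y, z, m, n, ∑ a, c a • v a, q] = ∑ a, c a * f ![x, y, z, m, n, v a, q] := by
  have h : ∀ t, Function.update ![x, y, z, m, n, 0, q] 5 t = ![x, y, z, m, n, t, q] := fun t => by
    ext i; fin_cases i <;> rfl
  simpa only [h] using map_update_sum_smul f c v ![x, y, z, m, n, 0, q] 5

lemma map_sum_slot_6 : f ![x, y, z, m, n, p, ∑ a, c a • v a] = ∑ a, c a * f ![x, y, z, m, n, p, v a] := by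
  have h : ∀ t, Function.update ![x, y, z, m, n, p, 0] 6 t = ![x, y, z, m, n, p, t] := fun t => by
    ext i; fin_cases i <;> rfl
  simpa only [h] using map_update_sum_smul f c v ![x, y, z, m, n, p, 0] 6

end AlternatingMap

lemma detRowAlternating_eq_det {n : Type*} [Fintype n] [DecidableEq n] (W : n → n → ℝ) :
    detRowAlternating W = (of W).det := rfl

lemma det_rows (A W : Matrix (Fin 7) (Fin 7) ℝ) (v : Fin 7 → Fin 7)
    (h : ∀ i j, W i j = A (v i) j) : W.det = A.det * altSymbol v := by
  rw [mul_comm, altSymbol, ← det_mul]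
  congr 1
  ext i j
  rw [h, Matrix.mul_apply]
  simp [Matrix.one_apply]

lemma exists_alternatingMap_rows : ∃ f : (Fin 7 → ℝ) [⋀^Fin 7]→ₗ[ℝ] ℝ,
    ∀ (A : Fin 7 → Fin 7 → ℝ) (a b c m n p q : Fin 7),
      f ![A a, A b, A c, A m, A n, A p, A q] =
        (of A).det * altSymbol ![a, b, c, m, n, p, q] := by
  refine ⟨detRowAlternating, fun A a b c m n p q => ?_⟩
  rw [detRowAlternating_eq_det]
  refine det_rows _ _ _ fun i j => ?_
  fin_cases i <;> rfl

/-- The determinant of three columns of B and four standard vectors is expanded in two ways: the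
columns in the standard basis, or the standard vectors in the columns of B, with coefficients from P
= B⁻¹. -/
lemma sum_altSymbol_frame {B P : Matrix (Fin 7) (Fin 7) ℝ} (h : B * P = 1)
    (i j k m n p q : Fin 7) :
    ∑ a, ∑ b, ∑ c, altSymbol ![a, b, c, m, n, p, q] * (B a i * B b j * B c k) =
      B.det * ∑ i', ∑ j', ∑ k', ∑ l', P i' m * P j' n * P k' p * P l' q *
        altSymbol ![i, j, k, i', j', k', l'] := by
  obtain ⟨R, hR⟩ : ∃ R : Fin 7 → Fin 7 → ℝ, ∀ i a, R i a = B a i := ⟨_, fun _ _ => rfl⟩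
  obtain ⟨e, he⟩ : ∃ e : Fin 7 → Fin 7 → ℝ, ∀ i a, e i a = if i = a then 1 else 0 :=
    ⟨_, fun _ _ => rfl⟩
  have hRdet : (of R).det = B.det := by
    rw [← det_transpose B]
    congr 1
    ext i a
    rw [of_apply, hR, transpose_apply]
  have hedet : (of e).det = 1 := by
    have : of e = 1 := by
      ext i a
      rw [of_apply, he, Matrix.one_apply]
    rw [this, det_one]
  have hB : ∀ i, R i = ∑ a, B a i • e a := fun i => by
    ext t; simp [Finset.sum_apply, hR, he]
  have hP : ∀ m, e m = ∑ a, P a m • R a := fun m => by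
    ext t
    have := congrFun (congrFun h t) m
    rw [Matrix.mul_apply, Matrix.one_apply] at this
    simp only [Finset.sum_apply, Pi.smul_apply, smul_eq_mul, hR, he, eq_comm (a := m)]
    rw [← this]
    exact Finset.sum_congr rfl fun _ _ => mul_comm _ _
  obtain ⟨f, hf⟩ := exists_alternatingMap_rows
  have e1 : f ![R i, R j, R k, e m, e n, e p, e q] =
      ∑ a, ∑ b, ∑ c, altSymbol ![a, b, c, m, n, p, q] * (B a i * B b j * B c k) := by
    rw [hB i, hB j, hB k]
    simp only [map_sum_slot_0]
    simp only [map_sum_slot_1]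
    simp only [map_sum_slot_2, hf, Finset.mul_sum, hedet]
    refine Finset.sum_congr rfl fun a _ => Finset.sum_congr rfl fun b _ =>
      Finset.sum_congr rfl fun c _ => ?_
    ring
  rw [← e1, hP m, hP n, hP p, hP q]
  simp only [map_sum_slot_3]
  simp only [map_sum_slot_4]
  simp only [map_sum_slot_5]
  simp only [map_sum_slot_6, hf, Finset.mul_sum, hRdet]
  refine Finset.sum_congr rfl fun a _ => Finset.sum_congr rfl fun b _ =>
    Finset.sum_congr rfl fun c _ => Finset.sum_congr rfl fun d _ => ?_
  ring

/-- The linear action of a matrix on 3-tensors. -/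
def frame3 (A : Matrix (Fin 7) (Fin 7) ℝ) (x : Comp3) : Comp3 := fun a b c =>
  ∑ i, ∑ j, ∑ k, A a i * A b j * A c k * x i j k

/-- The linear action of a matrix on 4-tensors. -/
def frame4 (A : Matrix (Fin 7) (Fin 7) ℝ) (x : Comp4) : Comp4 := fun a b c d =>
  ∑ i, ∑ j, ∑ k, ∑ l, A a i * A b j * A c k * A d l * x i j k l

lemma frame3_frame3 (A C : Matrix (Fin 7) (Fin 7) ℝ) (x : Comp3) :
    frame3 A (frame3 C x) = frame3 (A * C) x := by
  ext a b c
  have key : ∀ s : Fin 7 × Fin 7 × Fin 7,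
      (A * C) a s.1 * (A * C) b s.2.1 * (A * C) c s.2.2 =
      ∑ t : Fin 7 × Fin 7 × Fin 7, (A a t.1 * A b t.2.1 * A c t.2.2) *
        (C t.1 s.1 * C t.2.1 s.2.1 * C t.2.2 s.2.2) := fun s => by
    simp only [Matrix.mul_apply, Fintype.sum_prod_type]
    rw [Finset.sum_mul_sum, Finset.sum_mul]
    refine Finset.sum_congr rfl fun i _ => ?_
    rw [Finset.sum_mul]
    refine Finset.sum_congr rfl fun j _ => ?_
    rw [Finset.mul_sum]
    exact Finset.sum_congr rfl fun k _ => by ring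
  simp only [frame3, sum_three, key, Finset.sum_mul, Finset.mul_sum]
  rw [Finset.sum_comm]
  refine Finset.sum_congr rfl fun s _ => Finset.sum_congr rfl fun t _ => ?_
  ring

lemma sum_altSymbol_frame3 {B P : Matrix (Fin 7) (Fin 7) ℝ} (h : B * P = 1) (x : Comp3)
    (m n p q : Fin 7) :
    ∑ a, ∑ b, ∑ c, altSymbol ![a, b, c, m, n, p, q] * frame3 B x a b c =
      B.det * frame4 Pᵀ (fun m n p q =>
        ∑ a, ∑ b, ∑ c, altSymbol ![a, b, c, m, n, p, q] * x a b c) m n p q := by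
  have key := fun s : Fin 7 × Fin 7 × Fin 7 => sum_altSymbol_frame h s.1 s.2.1 s.2.2 m n p q
  simp only [sum_four] at key
  simp only [sum_three] at key
  have e : ∀ t : Fin 7 × Fin 7 × Fin 7, altSymbol ![t.1, t.2.1, t.2.2, m, n, p, q] *
      frame3 B x t.1 t.2.1 t.2.2 = ∑ s : Fin 7 × Fin 7 × Fin 7, x s.1 s.2.1 s.2.2 *
        (altSymbol ![t.1, t.2.1, t.2.2, m, n, p, q] *
          (B t.1 s.1 * B t.2.1 s.2.1 * B t.2.2 s.2.2)) := fun t => by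
    simp only [frame3, sum_three, Finset.mul_sum]
    exact Finset.sum_congr rfl fun s _ => by ring
  simp only [frame4, sum_four]
  simp only [sum_three, e]
  rw [Finset.sum_comm]
  simp only [← Finset.mul_sum, key]
  simp only [Finset.mul_sum]
  rw [Finset.sum_comm]
  refine Finset.sum_congr rfl fun s _ => Finset.sum_congr rfl fun t _ => ?_
  simp only [transpose_apply]
  ring

/-- The components of `φ₀`. -/
def phiStd : Comp3 := fun i j k => (phiInt i j k : ℝ)

/-- The components of `ψ₀`. -/
def psiStd : Comp4 := fun i j k l => (psiInt i j k l : ℝ)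

/-! ### Full contractions and their invariance under change of frame -/

/-- A full contraction of 2-tensors with the indices raised by `H`. -/
def contr (H X Y : Matrix (Fin 7) (Fin 7) ℝ) : ℝ := trace (Xᵀ * H * Y * Hᵀ)

lemma contr_eq_sum (H X Y : Matrix (Fin 7) (Fin 7) ℝ) :
    contr H X Y = ∑ c, ∑ d, X c d * ∑ c', ∑ d', H c c' * H d d' * Y c' d' := by
  have h : ∀ d, (Xᵀ * H * Y * Hᵀ) d d =
      ∑ c, X c d * ∑ c', ∑ d', H c c' * H d d' * Y c' d' := fun d => by
    rw [Matrix.mul_assoc, Matrix.mul_assoc, Matrix.mul_apply]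
    refine Finset.sum_congr rfl fun c _ => ?_
    rw [← Matrix.mul_assoc, Matrix.mul_apply, transpose_apply, Finset.sum_comm]
    congr 1
    refine Finset.sum_congr rfl fun d' _ => ?_
    rw [Matrix.mul_apply, Finset.sum_mul]
    exact Finset.sum_congr rfl fun c' _ => by rw [transpose_apply]; ring
  rw [contr, trace, Finset.sum_comm]
  exact Finset.sum_congr rfl fun d _ => h d

lemma contr_one (X Y : Matrix (Fin 7) (Fin 7) ℝ) : contr 1 X Y = ∑ c, ∑ d, X c d * Y c d := by
  rw [contr_eq_sum]
  simp [Matrix.one_apply]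

lemma contr_sum_smul_left {ι : Type*} [Fintype ι] (H Y : Matrix (Fin 7) (Fin 7) ℝ) (r : ι → ℝ)
    (X : ι → Matrix (Fin 7) (Fin 7) ℝ) :
    contr H (∑ i, r i • X i) Y = ∑ i, r i * contr H (X i) Y := by
  simp only [contr, transpose_sum, transpose_smul, Finset.sum_mul, smul_mul_assoc, trace_sum,
    trace_smul, smul_eq_mul]

lemma contr_sum_smul_right {ι : Type*} [Fintype ι] (H X : Matrix (Fin 7) (Fin 7) ℝ) (r : ι → ℝ)
    (Y : ι → Matrix (Fin 7) (Fin 7) ℝ) :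
    contr H X (∑ i, r i • Y i) = ∑ i, r i * contr H X (Y i) := by
  simp only [contr, Finset.mul_sum, Finset.sum_mul, mul_smul_comm, smul_mul_assoc, trace_sum,
    trace_smul, smul_eq_mul]

lemma contr_sum_sum_smul_right {ι κ : Type*} [Fintype ι] [Fintype κ]
    (H X : Matrix (Fin 7) (Fin 7) ℝ) (r : ι → κ → ℝ) (Y : ι → κ → Matrix (Fin 7) (Fin 7) ℝ) :
    contr H X (∑ i, ∑ j, r i j • Y i j) = ∑ i, ∑ j, r i j * contr H X (Y i j) := by
  simp only [contr, Finset.mul_sum, Finset.sum_mul, mul_smul_comm, smul_mul_assoc, trace_sum,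
    trace_smul, smul_eq_mul]

/-- BBᵀ is the inverse of the metric PᵀP, so each adjacent P and B cancel; the last pair meets by
cyclicity of the trace. -/
lemma contr_frame {B P : Matrix (Fin 7) (Fin 7) ℝ} (h : P * B = 1)
    (X Y : Matrix (Fin 7) (Fin 7) ℝ) :
    contr (B * Bᵀ) (Pᵀ * X * P) (Pᵀ * Y * P) = contr 1 X Y := by
  have h' : Bᵀ * Pᵀ = 1 := by rw [← transpose_mul, h, transpose_one]
  simp only [contr, transpose_mul, transpose_transpose, transpose_one, mul_one]
  have : Pᵀ * (Xᵀ * P) * (B * Bᵀ) * (Pᵀ * Y * P) * (B * Bᵀ) =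
      Pᵀ * Xᵀ * (P * B) * (Bᵀ * Pᵀ) * Y * (P * B) * Bᵀ := by
    simp only [Matrix.mul_assoc]
  rw [this, h, h', mul_one, mul_one, mul_one, trace_mul_comm]
  simp only [← Matrix.mul_assoc]
  rw [h', one_mul]

lemma frame3_slice (P : Matrix (Fin 7) (Fin 7) ℝ) (x : Comp3) (a : Fin 7) :
    of (frame3 Pᵀ x a) = ∑ i, P i a • (Pᵀ * of (x i) * P) := by
  ext b c
  simp only [frame3, Matrix.sum_apply, Matrix.smul_apply, Matrix.mul_apply, of_apply,
    transpose_apply, smul_eq_mul, Finset.mul_sum, Finset.sum_mul]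
  refine Finset.sum_congr rfl fun i _ => ?_
  rw [Finset.sum_comm]
  exact Finset.sum_congr rfl fun j _ => Finset.sum_congr rfl fun k _ => by ring

lemma frame4_slice (P : Matrix (Fin 7) (Fin 7) ℝ) (x : Comp4) (a b : Fin 7) :
    of (frame4 Pᵀ x a b) = ∑ i, ∑ j, (P i a * P j b) • (Pᵀ * of (x i j) * P) := by
  ext c d
  simp only [frame4, Matrix.sum_apply, Matrix.smul_apply, Matrix.mul_apply, of_apply,
    transpose_apply, smul_eq_mul, Finset.mul_sum, Finset.sum_mul]
  refine Finset.sum_congr rfl fun i _ => Finset.sum_congr rfl fun j _ => ?_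
  rw [Finset.sum_comm]
  exact Finset.sum_congr rfl fun j _ => Finset.sum_congr rfl fun k _ => by ring

lemma sum_vecCons {α R : Type*} [Fintype α] [AddCommMonoid R] {n : ℕ}
    (f : (Fin (n + 1) → α) → R) : ∑ v, f v = ∑ a, ∑ w : Fin n → α, f (vecCons a w) := by
  rw [← (Fin.consEquiv fun _ => α).sum_comp, Fintype.sum_prod_type]
  rfl

lemma sum_vec7 {α R : Type*} [Fintype α] [AddCommMonoid R] (f : (Fin 7 → α) → R) :
    ∑ v, f v = ∑ a, ∑ b, ∑ c, ∑ m, ∑ n, ∑ p, ∑ q, f ![a, b, c, m, n, p, q] := by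
  have h0 : ∀ g : (Fin 0 → α) → R, ∑ w, g w = g ![] := fun g => Fintype.sum_subsingleton g ![]
  simp only [sum_vecCons, h0]

/-! ### The metric and the dual 4-form of a positive 3-form -/

lemma sum_altSymbol_phiStd (m n p q : Fin 7) :
    ∑ a, ∑ b, ∑ c, altSymbol ![a, b, c, m, n, p, q] * phiStd a b c = 6 * psiStd m n p q :=
  sum_altSymbol_phiInt m n p q

lemma contr_phiStd_phiStd (i j : Fin 7) :
    contr 1 (of (phiStd i)) (of (phiStd j)) = if i = j then 6 else 0 := by
  rw [contr_one]
  exact sum_phiInt_phiInt i j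

lemma contr_phiStd_psiStd (i m n : Fin 7) :
    contr 1 (of (phiStd i)) (of (psiStd m n)) = 4 * phiStd i m n := by
  rw [contr_one]
  exact sum_phiInt_psiInt i m n

lemma frame4_smul (A : Matrix (Fin 7) (Fin 7) ℝ) (r : ℝ) (x : Comp4) :
    frame4 A (fun i j k l => r * x i j k l) = fun a b c d => r * frame4 A x a b c d := by
  ext a b c d
  simp only [frame4, Finset.mul_sum]
  refine Finset.sum_congr rfl fun _ _ => Finset.sum_congr rfl fun _ _ =>
    Finset.sum_congr rfl fun _ _ => Finset.sum_congr rfl fun _ _ => by ring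

lemma sum_altSymbol_frame3_phiStd {B P : Matrix (Fin 7) (Fin 7) ℝ} (h : B * P = 1)
    (m n p q : Fin 7) :
    ∑ a, ∑ b, ∑ c, altSymbol ![a, b, c, m, n, p, q] * frame3 B phiStd a b c =
      6 * B.det * frame4 Pᵀ psiStd m n p q := by
  rw [sum_altSymbol_frame3 h]
  simp only [sum_altSymbol_phiStd, frame4_smul]
  ring

/-- Contracting two indices with B = P⁻¹ undoes the frame there and leaves it only on the first
index. -/
lemma sum_mul_frame {B P : Matrix (Fin 7) (Fin 7) ℝ} (h : P * B = 1) (a i j : Fin 7) :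
    ∑ m, ∑ n, frame3 Pᵀ phiStd a m n * (B m i * B n j) = ∑ α, P α a * phiStd α i j := by
  have h' : Bᵀ * Pᵀ = 1 := by rw [← transpose_mul, h, transpose_one]
  have e : Bᵀ * of (frame3 Pᵀ phiStd a) * B = ∑ α, P α a • of (phiStd α) := by
    rw [frame3_slice, Finset.mul_sum, Finset.sum_mul]
    refine Finset.sum_congr rfl fun α _ => ?_
    rw [mul_smul_comm, smul_mul_assoc]
    have : Bᵀ * (Pᵀ * of (phiStd α) * P) * B = (Bᵀ * Pᵀ) * of (phiStd α) * (P * B) := by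
      simp only [Matrix.mul_assoc]
    rw [this, h, h', one_mul, mul_one]
  have := congrFun (congrFun e i) j
  simp only [Matrix.mul_apply, Matrix.sum_apply, Matrix.smul_apply, of_apply, transpose_apply,
    smul_eq_mul] at this
  rw [← this, Finset.sum_comm]
  refine Finset.sum_congr rfl fun n _ => ?_
  rw [Finset.sum_mul]
  exact Finset.sum_congr rfl fun m _ => by ring

lemma sum_mul_sum_mul_frame4 (X Y B : Matrix (Fin 7) (Fin 7) ℝ) (x : Comp4) :
    ∑ m, ∑ n, ∑ p, ∑ q, X m n * Y p q * frame4 B x m n p q =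
      ∑ i, ∑ j, ∑ k, ∑ l, (∑ m, ∑ n, X m n * (B m i * B n j)) *
        (∑ p, ∑ q, Y p q * (B p k * B q l)) * x i j k l := by
  have e : ∀ t : Fin 7 × Fin 7 × Fin 7 × Fin 7,
      (∑ m, ∑ n, X m n * (B m t.1 * B n t.2.1)) *
        (∑ p, ∑ q, Y p q * (B p t.2.2.1 * B q t.2.2.2)) * x t.1 t.2.1 t.2.2.1 t.2.2.2 =
      ∑ s : Fin 7 × Fin 7 × Fin 7 × Fin 7, X s.1 s.2.1 * (B s.1 t.1 * B s.2.1 t.2.1) *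
        (Y s.2.2.1 s.2.2.2 * (B s.2.2.1 t.2.2.1 * B s.2.2.2 t.2.2.2)) *
          x t.1 t.2.1 t.2.2.1 t.2.2.2 := fun t => by
    simp only [Fintype.sum_prod_type, Finset.sum_mul]
    refine Finset.sum_congr rfl fun m _ => Finset.sum_congr rfl fun n _ => ?_
    rw [Finset.mul_sum, Finset.sum_mul]
    refine Finset.sum_congr rfl fun p _ => ?_
    rw [Finset.mul_sum, Finset.sum_mul]
  simp only [frame4, sum_four]
  simp only [e]
  simp only [Finset.mul_sum]
  rw [Finset.sum_comm]
  exact Finset.sum_congr rfl fun s _ => Finset.sum_congr rfl fun t _ => by ring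

lemma sum_phiStd_phiStd_psiStd (α β : Fin 7) :
    ∑ i, ∑ j, ∑ k, ∑ l, phiStd α i j * phiStd β k l * psiStd i j k l = if α = β then 24 else 0 := by
  have h1 : ∀ i j, ∑ k, ∑ l, phiStd α i j * phiStd β k l * psiStd i j k l =
      4 * (phiStd α i j * phiStd β i j) := fun i j => by
    have := contr_phiStd_psiStd β i j
    rw [contr_one] at this
    simp only [of_apply] at this
    simp only [mul_assoc, ← Finset.mul_sum, this]
    ring
  have h2 := contr_phiStd_phiStd α β
  rw [contr_one] at h2
  simp only [of_apply] at h2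
  simp only [h1, ← Finset.mul_sum, h2]
  split_ifs <;> norm_num

/-- Summing the symbol against the third φ gives 6 det P times ψ₀ moved by B = P⁻¹; the other two φ
absorb that B, and the model contraction φ₀φ₀ψ₀ = 24δ finishes. -/
lemma sMatrix_frame3 {B P : Matrix (Fin 7) (Fin 7) ℝ} (h : P * B = 1) :
    sMatrix (frame3 Pᵀ phiStd) = P.det • (Pᵀ * P) := by
  have h' : Pᵀ * Bᵀ = 1 := by
    rw [← transpose_mul, mul_eq_one_comm.1 h, transpose_one]
  ext a b
  rw [sMatrix, of_apply, sum_vec7]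
  have e1 : ∀ m n p q : Fin 7, (∑ r, ∑ s, ∑ t, altSymbol ![m, n, p, q, r, s, t] *
      frame3 Pᵀ phiStd a (![m, n, p, q, r, s, t] 0) (![m, n, p, q, r, s, t] 1) *
      frame3 Pᵀ phiStd b (![m, n, p, q, r, s, t] 2) (![m, n, p, q, r, s, t] 3) *
      frame3 Pᵀ phiStd (![m, n, p, q, r, s, t] 4) (![m, n, p, q, r, s, t] 5)
        (![m, n, p, q, r, s, t] 6)) = frame3 Pᵀ phiStd a m n * frame3 Pᵀ phiStd b p q *
          (6 * P.det * frame4 B psiStd m n p q) := fun m n p q => by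
    have := sum_altSymbol_frame3_phiStd h' m n p q
    rw [transpose_transpose, det_transpose] at this
    rw [← this]
    simp only [Finset.mul_sum]
    refine Finset.sum_congr rfl fun r _ => Finset.sum_congr rfl fun s _ =>
      Finset.sum_congr rfl fun t _ => ?_
    rw [altSymbol_rotate]
    change _ * frame3 Pᵀ phiStd a m n * frame3 Pᵀ phiStd b p q * frame3 Pᵀ phiStd r s t = _
    ring
  simp only [e1]
  have e2 := sum_mul_sum_mul_frame4 (of (frame3 Pᵀ phiStd a)) (of (frame3 Pᵀ phiStd b)) B psiStd
  simp only [of_apply, sum_mul_frame h] at e2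
  have e3 : ∑ m, ∑ n, ∑ p, ∑ q, frame3 Pᵀ phiStd a m n * frame3 Pᵀ phiStd b p q *
      (6 * P.det * frame4 B psiStd m n p q) = 6 * P.det * ∑ m, ∑ n, ∑ p, ∑ q,
        frame3 Pᵀ phiStd a m n * frame3 Pᵀ phiStd b p q * frame4 B psiStd m n p q := by
    simp only [Finset.mul_sum]
    exact Finset.sum_congr rfl fun _ _ => Finset.sum_congr rfl fun _ _ =>
      Finset.sum_congr rfl fun _ _ => Finset.sum_congr rfl fun _ _ => by ring
  have e4 : ∑ i, ∑ j, ∑ k, ∑ l, (∑ α, P α a * phiStd α i j) * (∑ β, P β b * phiStd β k l) *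
      psiStd i j k l = ∑ α, ∑ β, P α a * P β b * if α = β then 24 else 0 := by
    simp only [← sum_phiStd_phiStd_psiStd, sum_four]
    have : ∀ t : Fin 7 × Fin 7 × Fin 7 × Fin 7,
        (∑ α, P α a * phiStd α t.1 t.2.1) * (∑ β, P β b * phiStd β t.2.2.1 t.2.2.2) *
          psiStd t.1 t.2.1 t.2.2.1 t.2.2.2 = ∑ s : Fin 7 × Fin 7,
        P s.1 a * P s.2 b * (phiStd s.1 t.1 t.2.1 * phiStd s.2 t.2.2.1 t.2.2.2 *
          psiStd t.1 t.2.1 t.2.2.1 t.2.2.2) := fun t => by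
      rw [Finset.sum_mul_sum, Finset.sum_mul, Fintype.sum_prod_type]
      refine Finset.sum_congr rfl fun _ _ => ?_
      rw [Finset.sum_mul]
      exact Finset.sum_congr rfl fun _ _ => by ring
    simp only [this]
    rw [Finset.sum_comm, Fintype.sum_prod_type]
    simp only [Finset.mul_sum]
  -- The product 6 · 24 = 144 cancels the normalising factor of `sMatrix`.
  rw [e3, e2, e4]
  simp only [mul_ite, mul_zero, Finset.sum_ite_eq, Finset.mem_univ, if_true, Matrix.smul_apply,
    Matrix.mul_apply, transpose_apply, smul_eq_mul, Finset.mul_sum]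
  exact Finset.sum_congr rfl fun _ _ => by ring

lemma ninthRoot_pow (t : ℝ) : ninthRoot (t ^ 9) = t := by
  have h : (|t| ^ 9) ^ (1 / 9 : ℝ) = |t| := by
    have := Real.pow_rpow_inv_natCast (abs_nonneg t) (n := 9) (by norm_num)
    rwa [show (1 / 9 : ℝ) = ((9 : ℕ) : ℝ)⁻¹ by norm_num]
  rw [ninthRoot, abs_pow, h]
  rcases lt_trichotomy t 0 with ht | rfl | ht
  · rw [sign_neg (Odd.pow_neg (by decide) ht), abs_of_neg ht]; simp
  · simp
  · rw [sign_pos (pow_pos ht 9), abs_of_pos ht]; simp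

/-- det(det P · PᵀP) = (det P)⁷(det P)² = (det P)⁹, and the odd ninth root recovers det P with its
sign, hence the orientation. -/
lemma volCoeff_frame3 {B P : Matrix (Fin 7) (Fin 7) ℝ} (h : P * B = 1) :
    volCoeff (frame3 Pᵀ phiStd) = P.det := by
  rw [volCoeff, sMatrix_frame3 h, det_smul, det_mul, det_transpose, Fintype.card_fin]
  rw [show P.det ^ 7 * (P.det * P.det) = P.det ^ 9 by ring, ninthRoot_pow]

lemma det_ne_zero_of_mul_eq_one {B P : Matrix (Fin 7) (Fin 7) ℝ} (h : P * B = 1) : P.det ≠ 0 := by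
  intro h0
  have := congrArg Matrix.det h
  rw [det_mul, h0, zero_mul, det_one] at this
  exact zero_ne_one this

lemma metricComp_frame3 {B P : Matrix (Fin 7) (Fin 7) ℝ} (h : P * B = 1) :
    metricComp (frame3 Pᵀ phiStd) = Pᵀ * P := by
  rw [metricComp, volCoeff_frame3 h, sMatrix_frame3 h, smul_smul,
    inv_mul_cancel₀ (det_ne_zero_of_mul_eq_one h), one_smul]

lemma inv_metric {B P : Matrix (Fin 7) (Fin 7) ℝ} (h : P * B = 1) : (Pᵀ * P)⁻¹ = B * Bᵀ := by
  refine Matrix.inv_eq_right_inv ?_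
  rw [show Pᵀ * P * (B * Bᵀ) = Pᵀ * (P * B) * Bᵀ by simp only [Matrix.mul_assoc], h, mul_one,
    ← transpose_mul, mul_eq_one_comm.1 h, transpose_one]

/-- Raising all indices of P*φ₀ with BBᵀ leaves φ₀ moved by B. The symbol then produces 6 det B,
which cancels 1/6 and the volume coefficient det P. -/
lemma psiComp_frame3 {B P : Matrix (Fin 7) (Fin 7) ℝ} (h : P * B = 1) :
    psiComp (Pᵀ * P) (frame3 Pᵀ phiStd) = frame4 Pᵀ psiStd := by
  have h' : Bᵀ * Pᵀ = 1 := by rw [← transpose_mul, h, transpose_one]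
  ext m n p q
  have e : ∀ a b c, ∑ a', ∑ b', ∑ c', (Pᵀ * P)⁻¹ a a' * (Pᵀ * P)⁻¹ b b' * (Pᵀ * P)⁻¹ c c' *
      frame3 Pᵀ phiStd a' b' c' = frame3 B phiStd a b c := fun a b c => by
    change frame3 _ (frame3 Pᵀ phiStd) a b c = _
    rw [frame3_frame3, inv_metric h, Matrix.mul_assoc, h', mul_one]
  have hd : P.det * B.det = 1 := by rw [← det_mul, h, det_one]
  simp only [psiComp, volCoeff_frame3 h, e]
  simp only [mul_assoc, ← Finset.mul_sum]
  rw [sum_altSymbol_frame3_phiStd (mul_eq_one_comm.1 h)]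
  linear_combination frame4 Pᵀ psiStd m n p q * hd

/-! ### Contraction identities -/

lemma contr_frame3_frame4 {B P : Matrix (Fin 7) (Fin 7) ℝ} (h : P * B = 1) (a m b : Fin 7) :
    contr (B * Bᵀ) (of (frame3 Pᵀ phiStd a)) (of (frame4 Pᵀ psiStd m b)) =
      4 * frame3 Pᵀ phiStd a m b := by
  rw [frame3_slice, frame4_slice]
  rw [contr_sum_smul_left]
  simp only [contr_sum_sum_smul_right, contr_frame h, contr_phiStd_psiStd, frame3,
    Finset.mul_sum, transpose_apply]
  exact Finset.sum_congr rfl fun _ _ => Finset.sum_congr rfl fun _ _ =>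
    Finset.sum_congr rfl fun _ _ => by ring

lemma contr_frame3_frame3 {B P : Matrix (Fin 7) (Fin 7) ℝ} (h : P * B = 1) (a b : Fin 7) :
    contr (B * Bᵀ) (of (frame3 Pᵀ phiStd a)) (of (frame3 Pᵀ phiStd b)) = 6 * (Pᵀ * P) a b := by
  rw [frame3_slice, frame3_slice, contr_sum_smul_left]
  simp only [contr_sum_smul_right, contr_frame h, contr_phiStd_phiStd, mul_ite, mul_zero,
    Finset.sum_ite_eq, Finset.mem_univ, if_true, Matrix.mul_apply, transpose_apply, Finset.mul_sum]
  exact Finset.sum_congr rfl fun _ _ => by ring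

lemma frame3_swap_left (A : Matrix (Fin 7) (Fin 7) ℝ) (a b c : Fin 7) :
    frame3 A phiStd a b c = - frame3 A phiStd b a c := by
  rw [frame3, frame3, Finset.sum_comm]
  simp only [← Finset.sum_neg_distrib]
  refine Finset.sum_congr rfl fun i _ => Finset.sum_congr rfl fun j _ =>
    Finset.sum_congr rfl fun k _ => ?_
  simp only [phiStd, (phiInt_swap j i k).1]
  push_cast
  ring

lemma frame3_swap_right (A : Matrix (Fin 7) (Fin 7) ℝ) (a b c : Fin 7) :
    frame3 A phiStd a b c = - frame3 A phiStd a c b := by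
  rw [frame3, frame3, ← Finset.sum_neg_distrib]
  refine Finset.sum_congr rfl fun i _ => ?_
  rw [Finset.sum_comm]
  simp only [← Finset.sum_neg_distrib]
  refine Finset.sum_congr rfl fun j _ => Finset.sum_congr rfl fun k _ => ?_
  simp only [phiStd, (phiInt_swap i k j).2]
  push_cast
  ring

/-! ### Pointwise `G₂`-structures -/

/-- A matrix and 3-tensor components that are carried to the standard metric and to `φ₀` by
a common invertible matrix. -/
def IsG2Pair (G : Matrix (Fin 7) (Fin 7) ℝ) (φ : Comp3) : Prop :=
  ∃ P B : Matrix (Fin 7) (Fin 7) ℝ, P * B = 1 ∧ φ = frame3 Pᵀ phiStd ∧ G = Pᵀ * P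

namespace IsG2Pair

variable {G : Matrix (Fin 7) (Fin 7) ℝ} {φ : Comp3} (h : IsG2Pair G φ)
include h

lemma metricComp_eq : metricComp φ = G := by
  obtain ⟨P, B, hPB, rfl, rfl⟩ := h
  exact metricComp_frame3 hPB

lemma symm (a b : Fin 7) : G a b = G b a := by
  obtain ⟨P, B, hPB, rfl, rfl⟩ := h
  simp only [Matrix.mul_apply, transpose_apply]
  exact Finset.sum_congr rfl fun _ _ => mul_comm _ _

lemma inv_symm (a b : Fin 7) : G⁻¹ a b = G⁻¹ b a := by
  obtain ⟨P, B, hPB, rfl, rfl⟩ := h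
  simp only [inv_metric hPB, Matrix.mul_apply, transpose_apply]
  exact Finset.sum_congr rfl fun _ _ => mul_comm _ _

lemma inv_mul : G⁻¹ * G = 1 := by
  obtain ⟨P, B, hPB, rfl, rfl⟩ := h
  rw [inv_metric hPB, show B * Bᵀ * (Pᵀ * P) = B * (Bᵀ * Pᵀ) * P by simp only [Matrix.mul_assoc],
    ← transpose_mul, hPB, transpose_one, mul_one, mul_eq_one_comm.1 hPB]

lemma sum_inv_mul (a c : Fin 7) : ∑ b, G⁻¹ a b * G b c = if a = c then 1 else 0 := by
  rw [← Matrix.mul_apply, h.inv_mul, Matrix.one_apply]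

lemma sum_mul_inv (a c : Fin 7) : ∑ b, G a b * G⁻¹ b c = if a = c then 1 else 0 := by
  rw [← Matrix.mul_apply, mul_eq_one_comm.1 h.inv_mul, Matrix.one_apply]

lemma swap_left (a b c : Fin 7) : φ a b c = - φ b a c := by
  obtain ⟨P, B, hPB, rfl, rfl⟩ := h
  exact frame3_swap_left _ _ _ _

lemma swap_right (a b c : Fin 7) : φ a b c = - φ a c b := by
  obtain ⟨P, B, hPB, rfl, rfl⟩ := h
  exact frame3_swap_right _ _ _ _

lemma rotate (a b c : Fin 7) : φ a b c = φ b c a := by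
  rw [h.swap_left, h.swap_right b a c, neg_neg]

lemma contr_psi (a m b : Fin 7) :
    contr G⁻¹ (of (φ a)) (of (psiComp G φ m b)) = 4 * φ a m b := by
  obtain ⟨P, B, hPB, rfl, rfl⟩ := h
  rw [inv_metric hPB, psiComp_frame3 hPB, contr_frame3_frame4 hPB]

lemma contr_phi (a b : Fin 7) : contr G⁻¹ (of (φ a)) (of (φ b)) = 6 * G a b := by
  obtain ⟨P, B, hPB, rfl, rfl⟩ := h
  rw [inv_metric hPB, contr_frame3_frame3 hPB]

lemma psi_swap_mid (m b c d : Fin 7) : psiComp G φ m b c d = - psiComp G φ m c b d := by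
  obtain ⟨P, B, hPB, rfl, rfl⟩ := h
  rw [psiComp_frame3 hPB, frame4, frame4, ← Finset.sum_neg_distrib]
  refine Finset.sum_congr rfl fun i _ => ?_
  rw [Finset.sum_comm]
  simp only [← Finset.sum_neg_distrib]
  refine Finset.sum_congr rfl fun j _ => Finset.sum_congr rfl fun k _ =>
    Finset.sum_congr rfl fun l _ => ?_
  simp only [psiStd, (psiInt_swap i k j l).1]
  push_cast
  ring

lemma psi_swap_right (m b c d : Fin 7) : psiComp G φ m b c d = - psiComp G φ m b d c := by
  obtain ⟨P, B, hPB, rfl, rfl⟩ := h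
  rw [psiComp_frame3 hPB, frame4, frame4, ← Finset.sum_neg_distrib]
  refine Finset.sum_congr rfl fun i _ => ?_
  rw [← Finset.sum_neg_distrib]
  refine Finset.sum_congr rfl fun j _ => ?_
  rw [Finset.sum_comm]
  simp only [← Finset.sum_neg_distrib]
  refine Finset.sum_congr rfl fun k _ => Finset.sum_congr rfl fun l _ => ?_
  simp only [psiStd, (psiInt_swap i j l k).2]
  push_cast
  ring

/-- The frame P is replaced by rP; no sign condition on r is needed. -/
lemma smul {r : ℝ} (hr : r ≠ 0) : IsG2Pair (r ^ 2 • G) (fun a b c => r ^ 3 * φ a b c) := by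
  obtain ⟨P, B, hPB, rfl, rfl⟩ := h
  refine ⟨r • P, r⁻¹ • B, ?_, ?_, ?_⟩
  · rw [smul_mul_smul_comm, hPB, mul_inv_cancel₀ hr, one_smul]
  · ext a b c
    simp only [frame3, Finset.mul_sum, transpose_apply, Matrix.smul_apply, smul_eq_mul]
    exact Finset.sum_congr rfl fun _ _ => Finset.sum_congr rfl fun _ _ =>
      Finset.sum_congr rfl fun _ _ => by ring
  · rw [transpose_smul, smul_mul_smul_comm, sq]

lemma psiComp_smul {r : ℝ} (hr : r ≠ 0) (m n p q : Fin 7) :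
    psiComp (r ^ 2 • G) (fun a b c => r ^ 3 * φ a b c) m n p q = r ^ 4 * psiComp G φ m n p q := by
  obtain ⟨P, B, hPB, rfl, rfl⟩ := h
  have hPB' : (r • P) * (r⁻¹ • B) = 1 := by
    rw [smul_mul_smul_comm, hPB, mul_inv_cancel₀ hr, one_smul]
  have e1 : (fun a b c => r ^ 3 * frame3 Pᵀ phiStd a b c) = frame3 (r • P)ᵀ phiStd := by
    ext a b c
    simp only [frame3, Finset.mul_sum, transpose_apply, Matrix.smul_apply, smul_eq_mul]
    exact Finset.sum_congr rfl fun _ _ => Finset.sum_congr rfl fun _ _ =>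
      Finset.sum_congr rfl fun _ _ => by ring
  have e2 : r ^ 2 • (Pᵀ * P) = (r • P)ᵀ * (r • P) := by
    rw [transpose_smul, smul_mul_smul_comm, sq]
  rw [e1, e2, psiComp_frame3 hPB', psiComp_frame3 hPB]
  simp only [frame4, Finset.mul_sum, transpose_apply, Matrix.smul_apply, smul_eq_mul]
  exact Finset.sum_congr rfl fun _ _ => Finset.sum_congr rfl fun _ _ =>
    Finset.sum_congr rfl fun _ _ => Finset.sum_congr rfl fun _ _ => by ring

lemma inv_smul {r : ℝ} (hr : r ≠ 0) : (r ^ 2 • G)⁻¹ = (r ^ 2)⁻¹ • G⁻¹ := by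
  refine Matrix.inv_eq_left_inv ?_
  rw [smul_mul_smul_comm, h.inv_mul, inv_mul_cancel₀ (pow_ne_zero 2 hr), one_smul]

end IsG2Pair

/-! ### The torsion in components -/

/-- The components `α^e` of a 1-form with its index raised. -/
def raise1 (H : Matrix (Fin 7) (Fin 7) ℝ) (α : Fin 7 → ℝ) (e : Fin 7) : ℝ := ∑ d, H e d * α d

/-- The components `ψ_m{}^{bcd}`. -/
def raise3 (H : Matrix (Fin 7) (Fin 7) ℝ) (ψ : Comp4) (m b c d : Fin 7) : ℝ :=
  ∑ b', ∑ c', ∑ d', H b b' * H c c' * H d d' * ψ m b' c' d'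

/-- The components of `α ⌟ φ`. -/
def contractComp (H : Matrix (Fin 7) (Fin 7) ℝ) (α : Fin 7 → ℝ) (φ : Comp3) (b c : Fin 7) : ℝ :=
  ∑ a, raise1 H α a * φ a b c

/-- The Christoffel symbols in terms of the inverse metric and the first derivatives
`dG c a b = ∂_c g_{ab}`. -/
def christoffelComp (H : Matrix (Fin 7) (Fin 7) ℝ) (dG : Comp3) (a e b : Fin 7) : ℝ :=
  (1 / 2) * ∑ d, H e d * (dG b d a + dG a d b - dG d a b)

/-- The components of `∇φ` in terms of the Christoffel symbols and the first derivatives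
`dφ a b c d = ∂_a φ_{bcd}`. -/
def covDerivComp (Γ : Comp3) (φ : Comp3) (dφ : Comp4) (a b c d : Fin 7) : ℝ :=
  dφ a b c d - ∑ e, (Γ a e b * φ e c d + Γ a e c * φ b e d + Γ a e d * φ b c e)

/-- The components of the full torsion tensor. -/
def torsionComp (H : Matrix (Fin 7) (Fin 7) ℝ) (ψ : Comp4) (D : Comp4) (a m : Fin 7) : ℝ :=
  (1 / 24) * ∑ b, ∑ c, ∑ d, D a b c d * raise3 H ψ m b c d

/-- Separating the index b reduces contractions with the raised ψ to the two-index pairing `contr`.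
-/
lemma sum_mul_raise3 (H X : Matrix (Fin 7) (Fin 7) ℝ) (ψ : Comp4) (m b : Fin 7) :
    ∑ c, ∑ d, X c d * raise3 H ψ m b c d = ∑ b', H b b' * contr H X (of (ψ m b')) := by
  simp only [contr_eq_sum, Finset.mul_sum, raise3, of_apply]
  have e : ∀ c, ∑ d, ∑ b', ∑ c', ∑ d', X c d * (H b b' * H c c' * H d d' * ψ m b' c' d') =
      ∑ b', ∑ d, ∑ c', ∑ d', X c d * (H b b' * H c c' * H d d' * ψ m b' c' d') := fun c =>
    Finset.sum_comm
  simp only [e]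
  rw [Finset.sum_comm]
  exact Finset.sum_congr rfl fun _ _ => Finset.sum_congr rfl fun _ _ =>
    Finset.sum_congr rfl fun _ _ => Finset.sum_congr rfl fun _ _ =>
    Finset.sum_congr rfl fun _ _ => by ring

lemma christoffelComp_conformal {G : Matrix (Fin 7) (Fin 7) ℝ} {φ : Comp3} (h : IsG2Pair G φ)
    {r : ℝ} (hr : r ≠ 0) (dG : Comp3) (df : Fin 7 → ℝ) (a e b : Fin 7) :
    christoffelComp (r ^ 2 • G)⁻¹ (fun c a b => r ^ 2 * dG c a b + 2 * r * df c * G a b) a e b =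
      christoffelComp G⁻¹ dG a e b + r⁻¹ * ((if e = a then 1 else 0) * df b +
        (if e = b then 1 else 0) * df a - raise1 G⁻¹ df e * G a b) := by
  -- Each Kronecker delta is written as G⁻¹G, so that the identity can be compared term by term in
  -- one sum over d.
  rw [h.inv_smul hr, ← h.sum_inv_mul, ← h.sum_inv_mul, christoffelComp, christoffelComp, raise1,
    Finset.sum_mul, Finset.sum_mul, Finset.sum_mul, ← Finset.sum_add_distrib,
    ← Finset.sum_sub_distrib, Finset.mul_sum, Finset.mul_sum, Finset.mul_sum,
    ← Finset.sum_add_distrib]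
  refine Finset.sum_congr rfl fun d _ => ?_
  rw [Matrix.smul_apply, smul_eq_mul]
  field_simp
  ring

/-- The three corrections containing df_a add up to 3r² df_a φ_{bcd}, exactly the term coming from
differentiating f³. The other corrections form the skew-symmetrisation over b, c, d. -/
lemma covDerivComp_conformal {G : Matrix (Fin 7) (Fin 7) ℝ} {φ : Comp3} (h : IsG2Pair G φ)
    {r : ℝ} (hr : r ≠ 0) (Γ Γ' : Comp3) (dφ : Comp4) (df : Fin 7 → ℝ)
    (hΓ : ∀ a e b, Γ' a e b = Γ a e b + r⁻¹ * ((if e = a then 1 else 0) * df b +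
        (if e = b then 1 else 0) * df a - raise1 G⁻¹ df e * G a b)) (a b c d : Fin 7) :
    covDerivComp Γ' (fun a b c => r ^ 3 * φ a b c)
        (fun a b c d => r ^ 3 * dφ a b c d + 3 * r ^ 2 * df a * φ b c d) a b c d =
      r ^ 3 * covDerivComp Γ φ dφ a b c d - r ^ 2 *
        ((df b * φ a c d - G a b * contractComp G⁻¹ df φ c d)
          - (df c * φ a b d - G a c * contractComp G⁻¹ df φ b d)
          + (df d * φ a b c - G a d * contractComp G⁻¹ df φ b c)) := by
  have e : ∀ e, Γ' a e b * (r ^ 3 * φ e c d) + Γ' a e c * (r ^ 3 * φ b e d) +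
      Γ' a e d * (r ^ 3 * φ b c e) = r ^ 3 * (Γ a e b * φ e c d + Γ a e c * φ b e d +
        Γ a e d * φ b c e) + r ^ 2 *
      (((if e = a then φ e c d * df b else 0) + (if e = b then φ e c d * df a else 0) -
        raise1 G⁻¹ df e * φ e c d * G a b) +
      ((if e = a then φ b e d * df c else 0) + (if e = c then φ b e d * df a else 0) +
        raise1 G⁻¹ df e * φ e b d * G a c) +
      ((if e = a then φ b c e * df d else 0) + (if e = d then φ b c e * df a else 0) -
        raise1 G⁻¹ df e * φ e b c * G a d)) := fun e => by
    rw [hΓ, hΓ, hΓ, h.swap_left b e d, ← h.rotate e b c]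
    have hr3 : r ^ 3 = r ^ 2 * r := by ring
    have hrr : r * r⁻¹ = 1 := mul_inv_cancel₀ hr
    split_ifs <;> field_simp <;> ring
  simp only [covDerivComp, e, contractComp]
  simp only [Finset.sum_add_distrib, Finset.sum_sub_distrib, ← Finset.mul_sum, ← Finset.sum_mul,
    Finset.sum_ite_eq', Finset.mem_univ, if_true]
  rw [h.swap_left b a d, ← h.rotate a b c]
  ring

namespace IsG2Pair

variable {G : Matrix (Fin 7) (Fin 7) ℝ} {φ : Comp3} (h : IsG2Pair G φ)
include h

lemma contractComp_swap (α : Fin 7 → ℝ) (b c : Fin 7) :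
    contractComp G⁻¹ α φ b c = - contractComp G⁻¹ α φ c b := by
  rw [contractComp, contractComp, ← Finset.sum_neg_distrib]
  exact Finset.sum_congr rfl fun a _ => by rw [h.swap_right a b c]; ring

lemma raise3_swap_left (m b c d : Fin 7) :
    raise3 G⁻¹ (psiComp G φ) m b c d = - raise3 G⁻¹ (psiComp G φ) m c b d := by
  rw [raise3, raise3, Finset.sum_comm]
  simp only [← Finset.sum_neg_distrib]
  refine Finset.sum_congr rfl fun i _ => Finset.sum_congr rfl fun j _ =>
    Finset.sum_congr rfl fun k _ => ?_
  rw [h.psi_swap_mid]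
  ring

lemma raise3_swap_right (m b c d : Fin 7) :
    raise3 G⁻¹ (psiComp G φ) m b c d = - raise3 G⁻¹ (psiComp G φ) m b d c := by
  rw [raise3, raise3, ← Finset.sum_neg_distrib]
  refine Finset.sum_congr rfl fun i _ => ?_
  rw [Finset.sum_comm]
  simp only [← Finset.sum_neg_distrib]
  refine Finset.sum_congr rfl fun j _ => Finset.sum_congr rfl fun k _ => ?_
  rw [h.psi_swap_right]
  ring

lemma raise1_contract (α : Fin 7 → ℝ) (a m : Fin 7) :
    ∑ b, α b * ∑ b', G⁻¹ b b' * (4 * φ a m b') = 4 * contractComp G⁻¹ α φ a m := by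
  simp only [contractComp, raise1, Finset.mul_sum, Finset.sum_mul]
  rw [Finset.sum_comm]
  refine Finset.sum_congr rfl fun e _ => Finset.sum_congr rfl fun d _ => ?_
  rw [h.inv_symm e d, h.rotate e a m]
  ring

/-- The first term gives 4(α ⌟ φ)_{am}, the second 4(α ⌟ φ)_{ma}; skew-symmetry turns their
difference into 8. -/
lemma sum_anti_raise3 (α : Fin 7 → ℝ) (a m : Fin 7) :
    ∑ b, ∑ c, ∑ d, (α b * φ a c d - G a b * contractComp G⁻¹ α φ c d) *
      raise3 G⁻¹ (psiComp G φ) m b c d = 8 * contractComp G⁻¹ α φ a m := by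
  have e1 : ∀ b, ∑ c, ∑ d, φ a c d * raise3 G⁻¹ (psiComp G φ) m b c d =
      ∑ b', G⁻¹ b b' * (4 * φ a m b') := fun b => by
    simpa only [h.contr_psi, of_apply] using sum_mul_raise3 G⁻¹ (of (φ a)) (psiComp G φ) m b
  have e2 : ∀ b, ∑ c, ∑ d, contractComp G⁻¹ α φ c d * raise3 G⁻¹ (psiComp G φ) m b c d =
      ∑ b', G⁻¹ b b' * (4 * contractComp G⁻¹ α φ m b') := fun b => by
    have hX : of (contractComp G⁻¹ α φ) = ∑ e, raise1 G⁻¹ α e • of (φ e) := by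
      ext c d
      simp only [Matrix.sum_apply, Matrix.smul_apply, of_apply, smul_eq_mul, contractComp]
    have := sum_mul_raise3 G⁻¹ (of (contractComp G⁻¹ α φ)) (psiComp G φ) m b
    simp only [of_apply] at this
    rw [this]
    refine Finset.sum_congr rfl fun b' _ => ?_
    rw [hX, contr_sum_smul_left, contractComp]
    simp only [h.contr_psi, Finset.mul_sum]
    exact Finset.sum_congr rfl fun _ _ => by ring
  have e3 : ∑ b, G a b * ∑ b', G⁻¹ b b' * (4 * contractComp G⁻¹ α φ m b') =
      4 * contractComp G⁻¹ α φ m a := by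
    simp only [Finset.mul_sum]
    rw [Finset.sum_comm]
    simp only [← mul_assoc, ← Finset.sum_mul, h.sum_mul_inv]
    simp
  simp only [sub_mul, Finset.sum_sub_distrib, mul_assoc, ← Finset.mul_sum, e1, e2, e3,
    h.raise1_contract]
  rw [h.contractComp_swap α m a]
  ring

/-- The raised ψ scales by r⁴ · r⁻⁶ = r⁻². Each of the three skew terms contributes 8 df ⌟ φ, and 3
· 8 cancels the factor 1/24. -/
lemma torsionComp_conformal {r : ℝ} (hr : r ≠ 0) (df : Fin 7 → ℝ) (D D' : Comp4)
    (hD : ∀ a b c d, D' a b c d = r ^ 3 * D a b c d - r ^ 2 *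
        ((df b * φ a c d - G a b * contractComp G⁻¹ df φ c d)
          - (df c * φ a b d - G a c * contractComp G⁻¹ df φ b d)
          + (df d * φ a b c - G a d * contractComp G⁻¹ df φ b c))) (a m : Fin 7) :
    torsionComp (r ^ 2 • G)⁻¹ (psiComp (r ^ 2 • G) (fun a b c => r ^ 3 * φ a b c)) D' a m =
      r * torsionComp G⁻¹ (psiComp G φ) D a m - contractComp G⁻¹ df φ a m := by
  have hΨ : ∀ b c d, raise3 (r ^ 2 • G)⁻¹ (psiComp (r ^ 2 • G) (fun a b c => r ^ 3 * φ a b c))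
      m b c d = (r ^ 2)⁻¹ * raise3 G⁻¹ (psiComp G φ) m b c d := fun b c d => by
    rw [h.inv_smul hr, raise3, raise3, Finset.mul_sum]
    refine Finset.sum_congr rfl fun i _ => ?_
    rw [Finset.mul_sum]
    refine Finset.sum_congr rfl fun j _ => ?_
    rw [Finset.mul_sum]
    refine Finset.sum_congr rfl fun k _ => ?_
    simp only [h.psiComp_smul hr, Matrix.smul_apply, smul_eq_mul]
    field_simp
  set Ψ := raise3 G⁻¹ (psiComp G φ) m with hΨdef
  set Y : Comp3 := fun b c d => df b * φ a c d - G a b * contractComp G⁻¹ df φ c d with hY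
  have s1 : ∑ b, ∑ c, ∑ d, Y b c d * Ψ b c d = 8 * contractComp G⁻¹ df φ a m :=
    h.sum_anti_raise3 df a m
  -- Exchanging two summation indices costs the sign of ψ, which matches the alternating signs in
  -- `hD`.
  have s2 : ∑ b, ∑ c, ∑ d, Y c b d * Ψ b c d = -(8 * contractComp G⁻¹ df φ a m) := by
    rw [← s1, Finset.sum_comm]
    simp only [← Finset.sum_neg_distrib]
    refine Finset.sum_congr rfl fun b _ => Finset.sum_congr rfl fun c _ =>
      Finset.sum_congr rfl fun d _ => ?_
    rw [hΨdef, h.raise3_swap_left m c b d]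
    ring
  have s3 : ∑ b, ∑ c, ∑ d, Y d b c * Ψ b c d = 8 * contractComp G⁻¹ df φ a m := by
    rw [← neg_neg (8 * _), ← s2, ← Finset.sum_neg_distrib]
    refine Finset.sum_congr rfl fun b _ => ?_
    rw [Finset.sum_comm]
    simp only [← Finset.sum_neg_distrib]
    refine Finset.sum_congr rfl fun c _ => Finset.sum_congr rfl fun d _ => ?_
    rw [hΨdef, h.raise3_swap_right m b c d]
    ring
  have e : ∀ b c d, D' a b c d * ((r ^ 2)⁻¹ * Ψ b c d) = r * (D a b c d * Ψ b c d) -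
      (Y b c d * Ψ b c d - Y c b d * Ψ b c d + Y d b c * Ψ b c d) := fun b c d => by
    rw [hD]
    simp only [hY]
    field_simp
  simp only [torsionComp, hΨ, e, Finset.sum_sub_distrib, Finset.sum_add_distrib, s1, s2, s3,
    ← Finset.mul_sum]
  ring

/-! ### The splitting of 2-tensors -/

lemma contr_contractComp (α : Fin 7 → ℝ) (c : Fin 7) :
    contr G⁻¹ (of (φ c)) (of (contractComp G⁻¹ α φ)) = 6 * α c := by
  have hX : of (contractComp G⁻¹ α φ) = ∑ e, raise1 G⁻¹ α e • of (φ e) := by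
    ext c d
    simp only [Matrix.sum_apply, Matrix.smul_apply, of_apply, smul_eq_mul, contractComp]
  rw [hX, contr_sum_smul_right]
  simp only [h.contr_phi, raise1, Finset.sum_mul]
  rw [Finset.sum_comm]
  have : ∀ d, ∑ e, G⁻¹ e d * α d * (6 * G c e) = 6 * α d * ∑ e, G c e * G⁻¹ e d := fun d => by
    rw [Finset.mul_sum]
    exact Finset.sum_congr rfl fun _ _ => by ring
  simp only [this, h.sum_mul_inv]
  simp

lemma trace_metric : ∑ a, ∑ b, G⁻¹ a b * G a b = 7 := by
  have : ∀ a, ∑ b, G⁻¹ a b * G a b = 1 := fun a => by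
    rw [show (1 : ℝ) = if a = a then 1 else 0 by simp, ← h.sum_inv_mul]
    exact Finset.sum_congr rfl fun b _ => by rw [h.symm]
  simp [this]

end IsG2Pair

/-- The components of the splitting `T = t g + α ⌟ φ + β + s`. -/
structure IsSplitting (G : Matrix (Fin 7) (Fin 7) ℝ) (φ : Comp3) (T : Matrix (Fin 7) (Fin 7) ℝ)
    (t : ℝ) (α : Fin 7 → ℝ) (β s : Matrix (Fin 7) (Fin 7) ℝ) : Prop where
  sum_eq : ∀ a b, T a b = t * G a b + contractComp G⁻¹ α φ a b + β a b + s a b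
  anti : ∀ a b, β a b = - β b a
  contr_eq_zero : ∀ c, contr G⁻¹ (of (φ c)) β = 0
  symm : ∀ a b, s a b = s b a
  trace_eq_zero : ∑ a, ∑ b, G⁻¹ a b * s a b = 0

lemma contr_sub_right (H X Y Z : Matrix (Fin 7) (Fin 7) ℝ) :
    contr H X (Y - Z) = contr H X Y - contr H X Z := by
  simp only [contr, Matrix.mul_sub, Matrix.sub_mul, trace_sub]

namespace IsG2Pair

variable {G : Matrix (Fin 7) (Fin 7) ℝ} {φ : Comp3} (h : IsG2Pair G φ)
include h

lemma exists_splitting (T : Matrix (Fin 7) (Fin 7) ℝ) : ∃ t α β s, IsSplitting G φ T t α β s := by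
  obtain ⟨S, hS⟩ : ∃ S : Matrix (Fin 7) (Fin 7) ℝ, ∀ a b, S a b = (T a b + T b a) / 2 :=
    ⟨of fun a b => (T a b + T b a) / 2, fun _ _ => rfl⟩
  obtain ⟨A, hA⟩ : ∃ A : Matrix (Fin 7) (Fin 7) ℝ, ∀ a b, A a b = (T a b - T b a) / 2 :=
    ⟨of fun a b => (T a b - T b a) / 2, fun _ _ => rfl⟩
  -- The divisors come from tr g = 7 (`trace_metric`) and from the contraction of φ with α ⌟ φ being
  -- 6α (`contr_contractComp`).
  obtain ⟨t, ht⟩ : ∃ t, t = (∑ a, ∑ b, G⁻¹ a b * S a b) / 7 := ⟨_, rfl⟩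
  obtain ⟨α, hα⟩ : ∃ α : Fin 7 → ℝ, ∀ c, α c = contr G⁻¹ (of (φ c)) A / 6 := ⟨_, fun _ => rfl⟩
  refine ⟨t, α, A - of (contractComp G⁻¹ α φ), S - t • G, ?_, ?_, ?_, ?_, ?_⟩
  · intro a b
    simp only [Matrix.sub_apply, Matrix.smul_apply, of_apply, smul_eq_mul, hS, hA]
    ring
  · intro a b
    simp only [Matrix.sub_apply, of_apply, hA, h.contractComp_swap α a b]
    ring
  · intro c
    rw [contr_sub_right, h.contr_contractComp, hα]
    ring
  · intro a b
    simp only [Matrix.sub_apply, Matrix.smul_apply, smul_eq_mul, hS, h.symm a b]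
    ring
  · have e : ∀ a b, G⁻¹ a b * (S - t • G) a b = G⁻¹ a b * S a b - t * (G⁻¹ a b * G a b) :=
      fun a b => by
        simp only [Matrix.sub_apply, Matrix.smul_apply, smul_eq_mul]
        ring
    simp only [e, Finset.sum_sub_distrib, ← Finset.mul_sum, h.trace_metric]
    rw [ht]
    ring

lemma splitting_unique {T : Matrix (Fin 7) (Fin 7) ℝ} {t t' : ℝ} {α α' : Fin 7 → ℝ}
    {β β' s s' : Matrix (Fin 7) (Fin 7) ℝ} (h₁ : IsSplitting G φ T t α β s)
    (h₂ : IsSplitting G φ T t' α' β' s') : t = t' ∧ α = α' ∧ β = β' ∧ s = s' := by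
  have hs : ∀ a b, t * G a b + s a b = t' * G a b + s' a b := fun a b => by
    -- Adding the equations at (a, b) and (b, a) removes the skew terms and isolates the symmetric
    -- part.
    have e1 := h₁.sum_eq a b
    have e2 := h₁.sum_eq b a
    have e3 := h₂.sum_eq a b
    have e4 := h₂.sum_eq b a
    rw [h.symm b a, h.contractComp_swap α b a, h₁.anti b a, h₁.symm b a] at e2
    rw [h.symm b a, h.contractComp_swap α' b a, h₂.anti b a, h₂.symm b a] at e4
    linarith
  have ha : ∀ a b, contractComp G⁻¹ α φ a b + β a b = contractComp G⁻¹ α' φ a b + β' a b :=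
    fun a b => by linarith [h₁.sum_eq a b, h₂.sum_eq a b, hs a b]
  have ht : t = t' := by
    have e : ∀ (u : ℝ) (w : Matrix (Fin 7) (Fin 7) ℝ), ∑ a, ∑ b, G⁻¹ a b * (u * G a b + w a b) =
        7 * u + ∑ a, ∑ b, G⁻¹ a b * w a b := fun u w => by
      simp only [mul_add, mul_left_comm _ u, Finset.sum_add_distrib, ← Finset.mul_sum,
        h.trace_metric]
      ring
    have e1 := e t s
    simp only [hs, e t' s', h₁.trace_eq_zero, h₂.trace_eq_zero] at e1
    linarith
  have hα : α = α' := by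
    ext c
    have e : β = of (contractComp G⁻¹ α' φ) - (of (contractComp G⁻¹ α φ) - β') := by
      ext a b
      simp only [Matrix.sub_apply, of_apply]
      linarith [ha a b]
    have := h₁.contr_eq_zero c
    rw [e, contr_sub_right, contr_sub_right, h.contr_contractComp, h.contr_contractComp,
      h₂.contr_eq_zero] at this
    linarith
  subst ht hα
  refine ⟨rfl, rfl, ?_, ?_⟩
  · ext a b
    linarith [ha a b]
  · ext a b
    linarith [hs a b]

end IsG2Pair

/-! ### Frames of a positive 3-form on a vector space -/

section Positive

variable {V : Type*} [AddCommGroup V] [Module ℝ V]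

lemma map_vec3_sum (f : (Fin 7 → ℝ) [⋀^Fin 3]→ₗ[ℝ] ℝ) (u v w : Fin 7 → ℝ)
    (b : Fin 7 → Fin 7 → ℝ) :
    f ![∑ i, u i • b i, ∑ j, v j • b j, ∑ k, w k • b k] =
      ∑ i, ∑ j, ∑ k, u i * v j * w k * f ![b i, b j, b k] := by
  have slot : ∀ (x : Fin 3 → Fin 7 → ℝ) (s : Fin 3) (c : Fin 7 → ℝ),
      f (Function.update x s (∑ i, c i • b i)) = ∑ i, c i * f (Function.update x s (b i)) :=
    fun x s c => by
      have := map_sum (f.toMultilinearMap.toLinearMap x s) (fun i => c i • b i) Finset.univ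
      simpa only [map_smul, MultilinearMap.toLinearMap_apply, AlternatingMap.coe_multilinearMap,
        smul_eq_mul] using this
  have h0 : ∀ p q t : Fin 7 → ℝ, Function.update ![0, p, q] 0 t = ![t, p, q] := fun p q t => by
    ext i; fin_cases i <;> rfl
  have h1 : ∀ p q t : Fin 7 → ℝ, Function.update ![p, 0, q] 1 t = ![p, t, q] := fun p q t => by
    ext i; fin_cases i <;> rfl
  have h2 : ∀ p q t : Fin 7 → ℝ, Function.update ![p, q, 0] 2 t = ![p, q, t] := fun p q t => by
    ext i; fin_cases i <;> rfl
  have s0 := fun p q c => slot ![0, p, q] 0 c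
  have s1 := fun p q c => slot ![p, 0, q] 1 c
  have s2 := fun p q c => slot ![p, q, 0] 2 c
  simp only [h0, h1, h2] at s0 s1 s2
  simp only [s0]
  simp only [s1]
  simp only [s2, Finset.mul_sum, mul_assoc]

lemma IsPositive.exists_frame {φ : V [⋀^Fin 3]→ₗ[ℝ] ℝ} (h : IsPositive φ)
    (b : Module.Basis (Fin 7) ℝ V) :
    ∃ P B : Matrix (Fin 7) (Fin 7) ℝ, P * B = 1 ∧
      (fun i j k => φ ![b i, b j, b k]) = frame3 Pᵀ phiStd := by
  obtain ⟨L, rfl⟩ := h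
  let e := Pi.basisFun ℝ (Fin 7)
  refine ⟨LinearMap.toMatrix b e L, LinearMap.toMatrix e b L.symm, ?_, ?_⟩
  · rw [← LinearMap.toMatrix_comp, LinearEquiv.comp_coe, LinearEquiv.symm_trans_self]
    simp
  · have hL : ∀ a, L (b a) = ∑ i, LinearMap.toMatrix b e L i a • Pi.single i (1 : ℝ) := fun a => by
      ext t
      simp [LinearMap.toMatrix_apply, e, Finset.sum_apply, Pi.single_apply]
    ext i j k
    have hv : ((L : V →ₗ[ℝ] (Fin 7 → ℝ)) ∘ ![b i, b j, b k]) = ![L (b i), L (b j), L (b k)] := by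
      ext t : 1; fin_cases t <;> rfl
    change phi0 ((L : V →ₗ[ℝ] (Fin 7 → ℝ)) ∘ ![b i, b j, b k]) = _
    rw [hv, hL, hL, hL, map_vec3_sum]
    simp only [phi0_single, frame3, phiStd, transpose_apply]

/-- The isomorphism L is replaced by rL; trilinearity produces the cube. -/
lemma IsPositive.smul {φ : V [⋀^Fin 3]→ₗ[ℝ] ℝ} (h : IsPositive φ) {r : ℝ} (hr : r ≠ 0) :
    IsPositive (r ^ 3 • φ) := by
  obtain ⟨L, rfl⟩ := h
  refine ⟨L.trans (LinearEquiv.smulOfNeZero ℝ (Fin 7 → ℝ) r hr), ?_⟩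
  ext v
  have := phi0.toMultilinearMap.map_smul_univ (fun _ => r) (fun i => L (v i))
  simp only [Finset.prod_const, Finset.card_univ, Fintype.card_fin] at this
  exact this.symm

end Positive

/-! ### From a `G₂`-structure on M to pointwise pairs -/

section Manifold

variable {M : Type*} [TopologicalSpace M] [ChartedSpace (EuclideanSpace ℝ (Fin 7)) M]

lemma IsG2Structure.isG2Pair {φ : Form3 M} {g : Tensor2 M} (h : IsG2Structure φ g) (x : M) :
    IsG2Pair (comp2 g x) (comp3 φ x) := by
  obtain ⟨P, B, hPB, hφ⟩ := (h.positive x).exists_frame (coordBasis x)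
  refine ⟨P, B, hPB, hφ, ?_⟩
  rw [h.metric_eq, ← metricComp_frame3 hPB, ← hφ]
  rfl

/-! ### Components in the base chart -/

/-- All tangent spaces are by definition the model space, so the same vectors can be used at two
equal points without transport. -/
lemma form3_congr (φ : Form3 M) {x y : M} (hxy : x = y) (v : Fin 3 → EuclideanSpace ℝ (Fin 7)) :
    (φ x : EuclideanSpace ℝ (Fin 7) [⋀^Fin 3]→ₗ[ℝ] ℝ) v =
      (φ y : EuclideanSpace ℝ (Fin 7) [⋀^Fin 3]→ₗ[ℝ] ℝ) v := by
  subst hxy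
  rfl

lemma tensor2_congr (g : Tensor2 M) {x y : M} (hxy : x = y) (v w : EuclideanSpace ℝ (Fin 7)) :
    (g x : LinearMap.BilinForm ℝ (EuclideanSpace ℝ (Fin 7))) v w =
      (g y : LinearMap.BilinForm ℝ (EuclideanSpace ℝ (Fin 7))) v w := by
  subst hxy
  rfl

variable [IsManifold (𝓡 7) ∞ M]

/-- The derivative of the inverse preferred chart is the identity at its base point. Hence chart
components there agree with the pointwise ones. -/
lemma coordField_self (x : M) (a : Fin 7) :
    (coordField x (extChartAt (𝓡 7) x x) a : EuclideanSpace ℝ (Fin 7)) =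
      (coordBasis x a : EuclideanSpace ℝ (Fin 7)) := by
  have : IsManifold (𝓡 7) 1 M := IsManifold.of_le (n := ∞) (by norm_num)
  have h := mfderivWithin_range_extChartAt_symm (I := 𝓡 7) (x := x)
  rw [ModelWithCorners.range_eq_univ, mfderivWithin_univ] at h
  have h' := congrArg (fun T : EuclideanSpace ℝ (Fin 7) →L[ℝ] EuclideanSpace ℝ (Fin 7) =>
    T (EuclideanSpace.single a 1)) h
  refine Eq.trans h' ?_
  change EuclideanSpace.single a (1 : ℝ) = (EuclideanSpace.basisFun (Fin 7) ℝ).toBasis a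
  simp

lemma chartComp3_self (φ : Form3 M) (x : M) (a b c : Fin 7) :
    chartComp3 φ x a b c (extChartAt (𝓡 7) x x) = comp3 φ x a b c := by
  refine (form3_congr φ (extChartAt_to_inv (I := 𝓡 7) x) _).trans ?_
  have e : (![coordField x (extChartAt (𝓡 7) x x) a, coordField x (extChartAt (𝓡 7) x x) b,
      coordField x (extChartAt (𝓡 7) x x) c] : Fin 3 → EuclideanSpace ℝ (Fin 7)) =
      ![coordBasis x a, coordBasis x b, coordBasis x c] := by
    rw [coordField_self, coordField_self, coordField_self]
    rfl
  exact congrArg (φ x : EuclideanSpace ℝ (Fin 7) [⋀^Fin 3]→ₗ[ℝ] ℝ) e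

lemma chartComp2_self (g : Tensor2 M) (x : M) (a b : Fin 7) :
    chartComp2 g x a b (extChartAt (𝓡 7) x x) = comp2 g x a b := by
  refine (tensor2_congr g (extChartAt_to_inv (I := 𝓡 7) x) _ _).trans ?_
  rw [coordField_self, coordField_self]
  rfl

lemma contDiffOn_comp_extChartAt_symm {f : M → ℝ} (hf : ContMDiff (𝓡 7) 𝓘(ℝ, ℝ) ∞ f) (x : M) :
    ContDiffOn ℝ ∞ (f ∘ (extChartAt (𝓡 7) x).symm) (extChartAt (𝓡 7) x).target := by
  rw [← contMDiffOn_iff_contDiffOn]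
  exact hf.comp_contMDiffOn (contMDiffOn_extChartAt_symm x)

omit [IsManifold (𝓡 7) ∞ M] in
lemma pderiv_comp_extChartAt_symm {f : M → ℝ} (x : M) (hf : MDifferentiableAt (𝓡 7) 𝓘(ℝ, ℝ) f x)
    (a : Fin 7) : pderiv a (f ∘ (extChartAt (𝓡 7) x).symm) (extChartAt (𝓡 7) x x) =
      differential f x (coordBasis x a) := by
  have h : mfderiv (𝓡 7) 𝓘(ℝ, ℝ) f x =
      fderiv ℝ (f ∘ (extChartAt (𝓡 7) x).symm) (extChartAt (𝓡 7) x x) := by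
    rw [hf.mfderiv, ModelWithCorners.range_eq_univ, fderivWithin_univ]
    rfl
  change fderiv ℝ _ _ _ = (mfderiv (𝓡 7) 𝓘(ℝ, ℝ) f x) (coordBasis x a)
  rw [h]
  congr 1
  change EuclideanSpace.single a (1 : ℝ) = (EuclideanSpace.basisFun (Fin 7) ℝ).toBasis a
  simp

end Manifold

section Manifold

variable {M : Type*} [TopologicalSpace M] [ChartedSpace (EuclideanSpace ℝ (Fin 7)) M]

/-! ### Tensors and their components -/

/-- The components of a 1-form at `x`. -/
def comp1 (α : Form1 M) (x : M) : Fin 7 → ℝ := fun a => α x (coordBasis x a)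

lemma comp2_toBilin (A : ∀ _ : M, Matrix (Fin 7) (Fin 7) ℝ) (x : M) :
    comp2 (fun x => Matrix.toBilin (coordBasis x) (A x)) x = A x := by
  ext a b
  rw [comp2, of_apply, ← LinearMap.BilinForm.toMatrix_apply, LinearMap.BilinForm.toMatrix_toBilin]

lemma tensor2_ext {x : M} {β γ : LinearMap.BilinForm ℝ (TangentSpace (𝓡 7) x)}
    (h : ∀ a b, β (coordBasis x a) (coordBasis x b) = γ (coordBasis x a) (coordBasis x b)) :
    β = γ :=
  LinearMap.BilinForm.ext_basis (coordBasis x) h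

lemma comp2_contract1 (g : Tensor2 M) (α : Form1 M) (φ : Form3 M) (x : M) (a b : Fin 7) :
    comp2 (contract1 g α φ) x a b =
      contractComp (comp2 g x)⁻¹ (comp1 α x) (comp3 φ x) a b := by
  have := congrFun (congrFun (comp2_toBilin (M := M) (fun x => Matrix.of fun b c =>
    ∑ a, ∑ e, (comp2 g x)⁻¹ a e * α x (coordBasis x e) * comp3 φ x a b c) x) a) b
  refine this.trans ?_
  simp only [of_apply, contractComp, raise1, Finset.sum_mul]
  rfl

lemma contract2_eq_contr {g : Tensor2 M} {φ : Form3 M} {x : M}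
    (h : IsG2Pair (comp2 g x) (comp3 φ x)) (β : Tensor2 M) (c : Fin 7) :
    contract2 g β φ x c = contr (comp2 g x)⁻¹ (of (comp3 φ x c)) (comp2 β x) := by
  simp only [contr_eq_sum, contract2, Finset.mul_sum, of_apply]
  refine Finset.sum_congr rfl fun a _ => Finset.sum_congr rfl fun b _ =>
    Finset.sum_congr rfl fun a' _ => Finset.sum_congr rfl fun b' _ => ?_
  rw [h.rotate c a b]
  ring

lemma isAlt_iff {x : M} (β : LinearMap.BilinForm ℝ (TangentSpace (𝓡 7) x)) :
    β.IsAlt ↔ ∀ a b, β (coordBasis x a) (coordBasis x b) =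
      - β (coordBasis x b) (coordBasis x a) := by
  refine ⟨fun h a b => (h.neg_eq _ _).symm, fun h v => ?_⟩
  have hflip : β = - β.flip := tensor2_ext fun a b => h a b
  have := congrArg (fun γ : LinearMap.BilinForm ℝ (TangentSpace (𝓡 7) x) => γ v v) hflip
  simp only [LinearMap.neg_apply] at this
  change β v v = - β v v at this
  linarith

lemma isSymm_iff {x : M} (β : LinearMap.BilinForm ℝ (TangentSpace (𝓡 7) x)) :
    β.IsSymm ↔ ∀ a b, β (coordBasis x a) (coordBasis x b) =
      β (coordBasis x b) (coordBasis x a) := by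
  refine ⟨fun h a b => h.eq _ _, fun h => ⟨fun v w => ?_⟩⟩
  have hflip : β = β.flip := tensor2_ext fun a b => h a b
  exact congrArg (fun γ : LinearMap.BilinForm ℝ (TangentSpace (𝓡 7) x) => γ v w) hflip

/-- This makes the torsion components a purely pointwise matter of linear algebra. -/
lemma areTorsionComponents_iff {φ : Form3 M} {g : Tensor2 M}
    (h : ∀ x, IsG2Pair (comp2 g x) (comp3 φ x)) (τ : TorsionComponents M) :
    AreTorsionComponents φ g τ ↔ ∀ x, IsSplitting (comp2 g x) (comp3 φ x)
      (comp2 (fullTorsion φ g) x) (τ.τ₁ x) (comp1 τ.τ₇ x) (comp2 τ.τ₁₄ x) (comp2 τ.τ₂₇ x) := by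
  constructor
  · intro hτ x
    refine ⟨fun a b => ?_, (isAlt_iff _).1 (hτ.alt_14 x), fun c => ?_,
      (isSymm_iff _).1 (hτ.symm_27 x), hτ.trace_27 x⟩
    · rw [← comp2_contract1, comp2, hτ.splitting x]
      rfl
    · rw [← contract2_eq_contr (h x), hτ.contract_14]
  · intro hτ
    refine ⟨fun x => tensor2_ext fun a b => ?_, fun x => (isAlt_iff _).2 (hτ x).anti,
      fun x c => ?_, fun x => (isSymm_iff _).2 (hτ x).symm, fun x => (hτ x).trace_eq_zero⟩
    · refine ((hτ x).sum_eq a b).trans ?_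
      rw [← comp2_contract1]
      rfl
    · rw [contract2_eq_contr (h x), (hτ x).contr_eq_zero]

lemma comp2_ext {β β' : Tensor2 M} {x : M} (h : comp2 β x = comp2 β' x) : β x = β' x :=
  tensor2_ext fun a b => congrFun (congrFun h a) b

/-- `TorsionComponents` carries no smoothness condition, so splittings chosen point by point
suffice. -/
lemma existsUnique_torsionComponents {φ : Form3 M} {g : Tensor2 M}
    (h : ∀ x, IsG2Pair (comp2 g x) (comp3 φ x)) :
    ∃! τ : TorsionComponents M, AreTorsionComponents φ g τ := by
  simp only [areTorsionComponents_iff h]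
  choose t α β s hs using fun x => (h x).exists_splitting (comp2 (fullTorsion φ g) x)
  refine ⟨⟨t, fun x => (coordBasis x).constr ℝ (α x), fun x => Matrix.toBilin (coordBasis x) (β x),
    fun x => Matrix.toBilin (coordBasis x) (s x)⟩, fun x => ?_, fun τ hτ => ?_⟩
  · have e : comp1 (fun x : M => (coordBasis x).constr ℝ (α x)) x = α x := by
      ext a
      exact (coordBasis x).constr_basis ℝ (α x) a
    simpa only [comp2_toBilin, e] using hs x
  · have e := fun x => (h x).splitting_unique (hτ x) (hs x)
    obtain ⟨τ₁, τ₇, τ₁₄, τ₂₇⟩ := τ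
    congr 1
    · exact funext fun x => (e x).1
    · refine funext fun x => (coordBasis x).ext fun a => ?_
      exact (congrFun (e x).2.1 a).trans ((coordBasis x).constr_basis ℝ (α x) a).symm
    · exact funext fun x => comp2_ext ((e x).2.2.1.trans (comp2_toBilin β x).symm)
    · exact funext fun x => comp2_ext ((e x).2.2.2.trans (comp2_toBilin s x).symm)

lemma comp2_fullTorsion (φ : Form3 M) (g : Tensor2 M) (x : M) (a m : Fin 7) :
    comp2 (fullTorsion φ g) x a m = torsionComp (comp2 g x)⁻¹ (psiComp (comp2 g x) (comp3 φ x))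
      (covDerivComp (christoffelComp (comp2 g x)⁻¹
        fun c a b => pderiv c (chartComp2 g x a b) (extChartAt (𝓡 7) x x)) (comp3 φ x)
        fun a b c d => pderiv a (chartComp3 φ x b c d) (extChartAt (𝓡 7) x x)) a m :=
  congrFun (congrFun (comp2_toBilin _ x) a) m

/-! ### The conformal change -/

lemma pderiv_mul {u v : EuclideanSpace ℝ (Fin 7) → ℝ} {p : EuclideanSpace ℝ (Fin 7)}
    (hu : DifferentiableAt ℝ u p) (hv : DifferentiableAt ℝ v p) (a : Fin 7) :
    pderiv a (fun y => u y * v y) p = u p * pderiv a v p + v p * pderiv a u p := by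
  simp [pderiv, fderiv_fun_mul hu hv]

lemma pderiv_pow {u : EuclideanSpace ℝ (Fin 7) → ℝ} {p : EuclideanSpace ℝ (Fin 7)}
    (hu : DifferentiableAt ℝ u p) (n : ℕ) (a : Fin 7) :
    pderiv a (fun y => u y ^ n) p = n * u p ^ (n - 1) * pderiv a u p := by
  simp [pderiv, fderiv_fun_pow n hu]

lemma chartComp3_smul {φ φ' : Form3 M} {f : M → ℝ} (h : ∀ x, φ' x = f x ^ 3 • φ x) (x₀ : M)
    (a b c : Fin 7) : chartComp3 φ' x₀ a b c =
      fun u => (f ∘ (extChartAt (𝓡 7) x₀).symm) u ^ 3 * chartComp3 φ x₀ a b c u := by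
  ext u
  rw [chartComp3, h]
  rfl

lemma chartComp2_smul {g g' : Tensor2 M} {f : M → ℝ} (h : ∀ x, g' x = f x ^ 2 • g x) (x₀ : M)
    (a b : Fin 7) : chartComp2 g' x₀ a b =
      fun u => (f ∘ (extChartAt (𝓡 7) x₀).symm) u ^ 2 * chartComp2 g x₀ a b u := by
  ext u
  rw [chartComp2, h]
  rfl

lemma comp3_smul {φ φ' : Form3 M} {r : ℝ} {x : M} (h : φ' x = r • φ x) :
    comp3 φ' x = fun a b c => r * comp3 φ x a b c := by
  ext a b c
  rw [comp3, h]
  rfl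

lemma comp2_smul {g g' : Tensor2 M} {r : ℝ} {x : M} (h : g' x = r • g x) :
    comp2 g' x = r • comp2 g x := by
  ext a b
  rw [comp2, h]
  rfl

lemma contractComp_smul {G : Matrix (Fin 7) (Fin 7) ℝ} {φ : Comp3} (h : IsG2Pair G φ) {r : ℝ}
    (hr : r ≠ 0) (α : Fin 7 → ℝ) (b c : Fin 7) :
    contractComp (r ^ 2 • G)⁻¹ α (fun a b c => r ^ 3 * φ a b c) b c =
      r * contractComp G⁻¹ α φ b c := by
  rw [h.inv_smul hr]
  simp only [contractComp, raise1, Matrix.smul_apply, smul_eq_mul, Finset.sum_mul, Finset.mul_sum]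
  refine Finset.sum_congr rfl fun _ _ => Finset.sum_congr rfl fun _ _ => ?_
  field_simp

lemma contractComp_sub_smul (H : Matrix (Fin 7) (Fin 7) ℝ) (φ : Comp3) (α α' : Fin 7 → ℝ) (r : ℝ)
    (b c : Fin 7) : contractComp H (fun a => α a - r * α' a) φ b c =
      contractComp H α φ b c - r * contractComp H α' φ b c := by
  simp only [contractComp, raise1, Finset.sum_mul, Finset.mul_sum, ← Finset.sum_sub_distrib]
  exact Finset.sum_congr rfl fun _ _ => Finset.sum_congr rfl fun _ _ => by ring

/-- Under the change α ⌟ φ scales by r⁻² · r³ = r, so −df ⌟ φ is the contraction of −r⁻¹ df for the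
new pair. The conditions on β and s are homogeneous and survive scaling. -/
lemma IsSplitting.conformal {G : Matrix (Fin 7) (Fin 7) ℝ} {φ : Comp3} (h : IsG2Pair G φ) {r : ℝ}
    (hr : r ≠ 0) {T T' : Matrix (Fin 7) (Fin 7) ℝ} {t : ℝ} {α : Fin 7 → ℝ}
    {β s : Matrix (Fin 7) (Fin 7) ℝ} (hs : IsSplitting G φ T t α β s) (df : Fin 7 → ℝ)
    (hT : ∀ a b, T' a b = r * T a b - contractComp G⁻¹ df φ a b) :
    IsSplitting (r ^ 2 • G) (fun a b c => r ^ 3 * φ a b c) T' (r⁻¹ * t)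
      (fun a => α a - r⁻¹ * df a) (r • β) (r • s) := by
  refine ⟨fun a b => ?_, fun a b => ?_, fun c => ?_, fun a b => ?_, ?_⟩
  · rw [hT, hs.sum_eq, contractComp_smul h hr, contractComp_sub_smul]
    simp only [Matrix.smul_apply, smul_eq_mul]
    field_simp
    ring
  · rw [Matrix.smul_apply, Matrix.smul_apply, hs.anti a b, smul_neg]
  · have e := hs.contr_eq_zero c
    have hφ : of (fun b d => r ^ 3 * φ c b d) = r ^ 3 • of (φ c) := rfl
    rw [h.inv_smul hr, hφ]
    simp only [contr, transpose_smul, smul_mul_assoc, mul_smul_comm, trace_smul]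
    rw [contr] at e
    simp [e]
  · rw [Matrix.smul_apply, Matrix.smul_apply, hs.symm a b]
  · have e : ∀ a b, (r ^ 2 • G)⁻¹ a b * (r • s) a b = (r ^ 2)⁻¹ * r * (G⁻¹ a b * s a b) :=
      fun a b => by
        rw [h.inv_smul hr, Matrix.smul_apply, Matrix.smul_apply, smul_eq_mul, smul_eq_mul]
        ring
    simp only [e, ← Finset.mul_sum, hs.trace_eq_zero, mul_zero]

variable [IsManifold (𝓡 7) ∞ M]

lemma IsG2Structure.conformal {φ φ' : Form3 M} {g g' : Tensor2 M} (hG : IsG2Structure φ g)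
    {f : M → ℝ} (hf : ContMDiff (𝓡 7) 𝓘(ℝ, ℝ) ∞ f) (hf0 : ∀ x, f x ≠ 0)
    (hφ' : ∀ x, φ' x = f x ^ 3 • φ x) (hg' : ∀ x, g' x = f x ^ 2 • g x) :
    IsG2Structure φ' g' where
  smooth_form x₀ a b c := by
    rw [chartComp3_smul hφ']
    exact ((contDiffOn_comp_extChartAt_symm hf x₀).pow 3).mul (hG.smooth_form x₀ a b c)
  smooth_metric x₀ a b := by
    rw [chartComp2_smul hg']
    exact ((contDiffOn_comp_extChartAt_symm hf x₀).pow 2).mul (hG.smooth_metric x₀ a b)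
  positive x := by
    rw [hφ']
    exact (hG.positive x).smul (hf0 x)
  metric_eq x := by
    rw [comp2_smul (hg' x), comp3_smul (hφ' x), ((hG.isG2Pair x).smul (hf0 x)).metricComp_eq]

lemma comp2_fullTorsion_conformal {φ φ' : Form3 M} {g g' : Tensor2 M} (hG : IsG2Structure φ g)
    {f : M → ℝ} (hf : ContMDiff (𝓡 7) 𝓘(ℝ, ℝ) ∞ f) (hf0 : ∀ x, f x ≠ 0)
    (hφ' : ∀ x, φ' x = f x ^ 3 • φ x) (hg' : ∀ x, g' x = f x ^ 2 • g x) (x : M) (a m : Fin 7) :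
    comp2 (fullTorsion φ' g') x a m = f x * comp2 (fullTorsion φ g) x a m -
      contractComp (comp2 g x)⁻¹ (comp1 (differential f) x) (comp3 φ x) a m := by
  have hp := hG.isG2Pair x
  have hmem : (extChartAt (𝓡 7) x).target ∈ nhds (extChartAt (𝓡 7) x x) :=
    extChartAt_target_mem_nhds x
  have hne : (∞ : WithTop ℕ∞) ≠ 0 := by norm_num
  have hfd : DifferentiableAt ℝ (f ∘ (extChartAt (𝓡 7) x).symm) (extChartAt (𝓡 7) x x) :=
    ((contDiffOn_comp_extChartAt_symm hf x).contDiffAt hmem).differentiableAt hne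
  have hφd : ∀ b c d, DifferentiableAt ℝ (chartComp3 φ x b c d) (extChartAt (𝓡 7) x x) :=
    fun b c d => ((hG.smooth_form x b c d).contDiffAt hmem).differentiableAt hne
  have hgd : ∀ b c, DifferentiableAt ℝ (chartComp2 g x b c) (extChartAt (𝓡 7) x x) :=
    fun b c => ((hG.smooth_metric x b c).contDiffAt hmem).differentiableAt hne
  have hfx : (f ∘ (extChartAt (𝓡 7) x).symm) (extChartAt (𝓡 7) x x) = f x := by
    rw [Function.comp_apply, extChartAt_to_inv]
  have hdf : ∀ a, pderiv a (f ∘ (extChartAt (𝓡 7) x).symm) (extChartAt (𝓡 7) x x) =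
      comp1 (differential f) x a :=
    pderiv_comp_extChartAt_symm x (hf.mdifferentiableAt hne)
  -- The product rule at the base point brings ∂φ̃, and below ∂g̃, to the form that the component
  -- lemmas expect.
  have hdφ : (fun a b c d => pderiv a (chartComp3 φ' x b c d) (extChartAt (𝓡 7) x x)) =
      fun a b c d => f x ^ 3 * pderiv a (chartComp3 φ x b c d) (extChartAt (𝓡 7) x x) +
        3 * f x ^ 2 * comp1 (differential f) x a * comp3 φ x b c d := by
    ext a b c d
    rw [chartComp3_smul hφ', pderiv_mul (hfd.fun_pow 3) (hφd b c d), pderiv_pow hfd, hfx, hdf,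
      chartComp3_self]
    push_cast
    ring
  have hdg : (fun c a b => pderiv c (chartComp2 g' x a b) (extChartAt (𝓡 7) x x)) =
      fun c a b => f x ^ 2 * pderiv c (chartComp2 g x a b) (extChartAt (𝓡 7) x x) +
        2 * f x * comp1 (differential f) x c * comp2 g x a b := by
    ext c a b
    rw [chartComp2_smul hg', pderiv_mul (hfd.fun_pow 2) (hgd a b), pderiv_pow hfd, hfx, hdf,
      chartComp2_self]
    push_cast
    ring
  rw [comp2_fullTorsion, comp2_fullTorsion, hdφ, hdg, comp2_smul (hg' x), comp3_smul (hφ' x)]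
  refine hp.torsionComp_conformal (hf0 x) _ _ _ (fun a b c d => ?_) a m
  exact covDerivComp_conformal hp (hf0 x) _ _ _ _
    (christoffelComp_conformal hp (hf0 x) _ _) a b c d

end Manifold

end G2

end

/-! ### The conformal change of the torsion -/

theorem mainTheorem8 {M : Type*} [TopologicalSpace M]
    [ChartedSpace (EuclideanSpace ℝ (Fin 7)) M] [IsManifold (𝓡 7) ∞ M]
    (φ : G2.Form3 M) (g : G2.Tensor2 M) (hG : G2.IsG2Structure φ g)
    (f : M → ℝ) (hf : ContMDiff (𝓡 7) 𝓘(ℝ, ℝ) ∞ f) (hf0 : ∀ x, f x ≠ 0)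
    (φ' : G2.Form3 M) (hφ' : ∀ x, φ' x = f x ^ 3 • φ x)
    (g' : G2.Tensor2 M) (hg' : ∀ x, g' x = f x ^ 2 • g x) :
    -- the conformally changed pair is again a `G₂`-structure
    G2.IsG2Structure φ' g' ∧
    -- the full torsion tensor changes by `T' = f T - df ⌟ φ`
    (∀ x, G2.fullTorsion φ' g' x =
      f x • G2.fullTorsion φ g x - G2.contract1 g (G2.differential f) φ x) ∧
    -- both structures have uniquely determined torsion components
    (∃! τ : G2.TorsionComponents M, G2.AreTorsionComponents φ g τ) ∧
    (∃! τ' : G2.TorsionComponents M, G2.AreTorsionComponents φ' g' τ') ∧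
    ∀ τ τ' : G2.TorsionComponents M,
      G2.AreTorsionComponents φ g τ → G2.AreTorsionComponents φ' g' τ' →
      ∀ x,
        -- the `W₁`, `W₁₄` and `W₂₇` components of the torsion tensor are multiplied by `f`
        τ'.τ₁ x • g' x = f x • (τ.τ₁ x • g x) ∧
        τ'.τ₁₄ x = f x • τ.τ₁₄ x ∧
        τ'.τ₂₇ x = f x • τ.τ₂₇ x ∧
        -- the `W₇` component is multiplied by `f` and shifted by `- df ⌟ φ`
        G2.contract1 g' τ'.τ₇ φ' x =
          f x • G2.contract1 g τ.τ₇ φ x - G2.contract1 g (G2.differential f) φ x ∧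
        -- equivalently, for the function `τ₁` and the 1-form `τ₇`
        τ'.τ₁ x = (f x)⁻¹ * τ.τ₁ x ∧
        τ'.τ₇ x = τ.τ₇ x - (f x)⁻¹ • G2.differential f x := by
  have hG' := hG.conformal hf hf0 hφ' hg'
  have hT := G2.comp2_fullTorsion_conformal hG hf hf0 hφ' hg'
  refine ⟨hG', fun x => G2.tensor2_ext fun a b => ?_,
    G2.existsUnique_torsionComponents hG.isG2Pair,
    G2.existsUnique_torsionComponents hG'.isG2Pair, fun τ τ' hτ hτ' x => ?_⟩
  · refine (hT x a b).trans ?_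
    rw [← G2.comp2_contract1]
    rfl
  have hp := hG.isG2Pair x
  -- `h₁` splits the new torsion using the rescaled components of τ, `h₂` using τ'; uniqueness for
  -- the scaled pair compares them.
  have h₁ := ((G2.areTorsionComponents_iff hG.isG2Pair τ).1 hτ x).conformal hp (hf0 x)
    (G2.comp1 (G2.differential f) x) (hT x)
  have h₂ := (G2.areTorsionComponents_iff hG'.isG2Pair τ').1 hτ' x
  have hp' := hG'.isG2Pair x
  rw [G2.comp2_smul (hg' x), G2.comp3_smul (hφ' x)] at h₂ hp'
  obtain ⟨e₁, e₇, e₁₄, e₂₇⟩ := hp'.splitting_unique h₂ h₁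
  have h₇ : τ'.τ₇ x = τ.τ₇ x - (f x)⁻¹ • G2.differential f x :=
    (G2.coordBasis x).ext fun a => congrFun e₇ a
  refine ⟨?_, G2.tensor2_ext fun a b => congrFun (congrFun e₁₄ a) b,
    G2.tensor2_ext fun a b => congrFun (congrFun e₂₇ a) b, G2.tensor2_ext fun a b => ?_, e₁, h₇⟩
  · rw [e₁, hg', smul_smul, smul_smul]
    congr 1
    field_simp [hf0 x]
  · refine (G2.comp2_contract1 g' τ'.τ₇ φ' x a b).trans ?_
    rw [G2.comp2_smul (hg' x), G2.comp3_smul (hφ' x), G2.contractComp_smul hp (hf0 x), e₇,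
      G2.contractComp_sub_smul, mul_sub, mul_inv_cancel_left₀ (hf0 x), ← G2.comp2_contract1,
      ← G2.comp2_contract1]
    rfl
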